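/- Let $\Bbbk$ be an algebraically closed field of characteristic zero, let $\mathbb V$ be a finite-dimensional $\Bbbk$-vector space with a nondegenerate symmetric bilinear form, and let $\mathfrak g=\mathfrak{so}(\mathbb V)$, where $\dim\mathbb V=2\ell+1$ or $2\ell$. For $x\in\mathfrak g$ let $Q_i(x)$ be the coefficient of degree $\dim\mathbb V-i$ of the characteristic polynomial of $x$. Put $q_i=Q_{2i}$ for $1\le i\le \ell$, except that when $\dim\mathbb V=2\ell$ one takes for $q_\ell$ a polynomial function on $\mathfrak g$ with $q_\ell^2=Q_{2\ell}$. Let $(e,h,f)$ be an $\mathfrak{sl}_2$-triple of $\mathfrak g$ and $\lambda=(\lambda_1\ge\dots\ge\lambda_k)$ the partition of $\dim\mathbb V$ given by the Jordan blocks of $e$. For a polynomial function $q$ on $\mathfrak g$, let ${}^e q$ be the initial homogeneous component (the nonzero homogeneous component of least degree) of the function $x\mapsto q(e+x)$ on the centralizer $\mathfrak g^f$. *Very good sequences.* Let $\lambda=(\lambda_1\ge\dots\ge\lambda_k)$ be a sequence of positive integers in which every even integer has even multiplicity, and let $n_\lambda$ be its number of even entries. Define $d_\lambda$ recursively: if $k=2$,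 $d_\lambda=n_\lambda$. If $k>2$ and $\lambda_k,\lambda_{k-1}$ are odd, $d_\lambda=d_{(\lambda_1,\dots,\lambda_{k-2})}$. If $k>2$ and $\lambda_k,\lambda_{k-1}$ are even, $d_\lambda=d_{(\lambda_1,\dots,\lambda_{k-2})}+2$. If $k>4$, $\lambda_k$ is odd and for some $c\in\{2,\dots,k-2\}$ the integer $\lambda_c$ is odd and $\lambda_{c+1},\dots,\lambda_{k-1}$ are even, $d_\lambda=d_{(\lambda_1,\dots,\lambda_{c-1})}$. In all other cases $d_\lambda=0$. The sequence is *very good* if $n_\lambda=d_\lambda$ when $k$ is odd and $d_\lambda=0$ when $k$ is even (the empty sequence is very good). *Condition $(\ast)$.* For some $k'\in\{2,\dots,k\}$, $\lambda_i$ is even for all $i\le k'$ and $(\lambda_{k'+1},\dots,\lambda_k)$ is very good. (Then $k'$ is even.) Assume $(\ast)$. Put $\nu_i=(\lambda_1+\dots+\lambda_i)/2$ for $1\le i\le k'$, $p_0=1$, and $p_i={}^e q_{\nu_i}$ for $1\le i\le k'$, except that $p_k=({}^e q_{\nu_k})^2$ if $k'=k$. Decompose $\mathbb V=\mathbb V_1\oplus\dots\oplus\mathbb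 V_k$ into simple modules over the subalgebra generated by $e,h,f$, with $\dim\mathbb V_i=\lambda_i$, in such a way that the subspaces $\mathbb V[0]=\mathbb V_{k'+1}\oplus\dots\oplus\mathbb V_k$ and $\mathbb V[i]=\mathbb V_{2i-1}\oplus\mathbb V_{2i}$ ($1\le i\le k'/2$) are pairwise orthogonal. Let $\overline{\mathfrak g}=\bigoplus_{i=0}^{k'/2}\mathfrak{so}(\mathbb V[i])$, let $\overline{\mathfrak g}^f$ be the centralizer of $f$ in $\overline{\mathfrak g}$, and let $\overline p_i$ be the restriction of $p_i$ to $\overline{\mathfrak g}^f$. Let $\varepsilon_i$ be the endomorphism of $\mathbb V$ that equals $e^{\lambda_i-1}$ on $\mathbb V_i$ and $0$ on the other summands, and let $z_l=\varepsilon_{2l-1}+\varepsilon_{2l}$ for $1\le l\le k'/2$, regarded as a linear function on $\overline{\mathfrak g}^f$ through the invariant form $\langle x,y\rangle=\frac12\operatorname{tr}(xy)$ on $\mathfrak g$ (the Killing form multiplied by $\frac1{2(\dim\mathbb V-2)}$). Let $\mu_1>\dots>\mu_m$ be the distinct values of $\lambda_1,\dots,\lambda_{k'}$, let $k_1,\dots,k_m$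 be their multiplicities in this sequence, and put $k_0=0$. For $1\le s\le m$ and $r\ge0$ let $\sigma^{(s)}_r$ be the elementary symmetric function of degree $r$ in the $z_l$ with $\frac{k_0+\dots+k_{s-1}}2<l\le\frac{k_0+\dots+k_s}2$ (so $\sigma^{(s)}_0=1$, and $\sigma^{(s)}_r=0$ for $r>k_s/2$). Then for all $s\in\{1,\dots,m\}$ and $j\in\{1,\dots,k_s\}$, as functions on $\overline{\mathfrak g}^f$, $$\overline p_{k_0+\dots+k_{s-1}+j}=(-1)^j\,\overline p_{k_0+\dots+k_{s-1}}\sum_{r=0}^{j}\sigma^{(s)}_{j-r}\sigma^{(s)}_r=(-1)^j\Big(\sigma^{(1)}_{k_1/2}\cdots\sigma^{(s-1)}_{k_{s-1}/2}\Big)^2\sum_{r=0}^{j}\sigma^{(s)}_{j-r}\sigma^{(s)}_r ,$$ the product over $\sigma^{(1)},\dots,\sigma^{(s-1)}$ being $1$ for $s=1$. -/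

import Mathlib

open Polynomial

/-! ### Orthogonal partitions, very good partitions

A sequence `(λ_1, …, λ_k)` is given by a function `lam : ℕ → ℕ` and the length `k`;
only the values `lam i` with `1 ≤ i ≤ k` matter. -/

/-- `(λ_1 ≥ ⋯ ≥ λ_k)` is a sequence of positive integers in which every even integer has even
multiplicity, i.e. it is the partition of a nilpotent orbit of an orthogonal Lie algebra. -/
structure IsOrthPartition (lam : ℕ → ℕ) (k : ℕ) : Prop where
  pos : ∀ i, 1 ≤ i → i ≤ k → 0 < lam i
  anti : ∀ i j, 1 ≤ i → i ≤ j → j ≤ k → lam j ≤ lam i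
  even_mult : ∀ a, Even a → Even ((Finset.Icc 1 k).filter (fun i => lam i = a)).card

/-- The number `n_λ` of even integers in the sequence. -/
def nEven (lam : ℕ → ℕ) (k : ℕ) : ℕ := ((Finset.Icc 1 k).filter (fun i => Even (lam i))).card

/-- `λ_k` and `λ_{k-1}` are odd. -/
def Cond1 (lam : ℕ → ℕ) (k : ℕ) : Prop := 2 ≤ k ∧ Odd (lam k) ∧ Odd (lam (k - 1))

/-- `λ_k` and `λ_{k-1}` are even. -/
def Cond2 (lam : ℕ → ℕ) (k : ℕ) : Prop := 2 ≤ k ∧ Even (lam k) ∧ Even (lam (k - 1))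

/-- `k > 4`, `λ_k` is odd, `c ∈ {2, …, k-2}`, `λ_c` is odd and `λ_i` is even for
`i ∈ {c+1, …, k-1}`. -/
def Cond4 (lam : ℕ → ℕ) (k c : ℕ) : Prop :=
  4 < k ∧ Odd (lam k) ∧ 2 ≤ c ∧ c ≤ k - 2 ∧ Odd (lam c) ∧
    ∀ i, c + 1 ≤ i → i ≤ k - 1 → Even (lam i)

open Classical in
/-- The integer `d_λ`. The sequence `λ^*` is always an initial segment of `λ`, so the recursion is
on the length. The last line covers the two remaining kinds of sequences of length `≠ 2`, namely
`k > 3`, `λ_1`, `λ_k` odd and all other `λ_i` even, or `k = 1`, or `λ_k` odd and all other `λ_i`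
even; and the empty sequence. -/
noncomputable def dNum (lam : ℕ → ℕ) (k : ℕ) : ℕ :=
  if k = 2 then nEven lam k
  else if h1 : Cond1 lam k then dNum lam (k - 2)
  else if h2 : Cond2 lam k then dNum lam (k - 2) + 2
  else if h4 : ∃ c, Cond4 lam k c then dNum lam (Classical.choose h4 - 1)
  else 0
termination_by k
decreasing_by
  · have := h1.1; omega
  · have := h2.1; omega
  · have := Classical.choose_spec h4
    obtain ⟨a, _, b, c, _⟩ := this
    omega

/-- Very good sequences (the empty sequence is very good). -/
structure IsVeryGood (lam : ℕ → ℕ) (k : ℕ) : Prop where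
  orth : IsOrthPartition lam k
  odd_case : Odd k → nEven lam k = dNum lam k
  even_case : Even k → dNum lam k = 0

/-- The condition `(∗)`, with the integer `k'` made explicit: `2 ≤ k' ≤ k`, the `λ_i` with
`i ≤ k'` are even, and `(λ_{k'+1}, …, λ_k)` is very good. -/
structure StarCondition (lam : ℕ → ℕ) (k k' : ℕ) : Prop where
  two_le : 2 ≤ k'
  le : k' ≤ k
  even : ∀ i, 1 ≤ i → i ≤ k' → Even (lam i)
  veryGood : IsVeryGood (fun i => lam (k' + i)) (k - k')

/-! ### Values and multiplicities of `(λ_1, …, λ_{k'})` -/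

/-- The number `m` of distinct values of `(λ_1, …, λ_{k'})`. -/
def numValues (lam : ℕ → ℕ) (k' : ℕ) : ℕ := ((Finset.Icc 1 k').image lam).card

/-- `μ_s` for `1 ≤ s ≤ m`: the values of `(λ_1, …, λ_{k'})` in strictly decreasing order. -/
def muVal (lam : ℕ → ℕ) (k' s : ℕ) : ℕ :=
  (((Finset.Icc 1 k').image lam).sort (fun a b => b ≤ a)).getD (s - 1) 0

/-- The multiplicity `k_s` of `μ_s` in `(λ_1, …, λ_{k'})`, and `k_0 = 0`. -/
def multVal (lam : ℕ → ℕ) (k' s : ℕ) : ℕ :=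
  if s = 0 then 0 else ((Finset.Icc 1 k').filter (fun i => lam i = muVal lam k' s)).card

/-- `k_0 + ⋯ + k_s`. -/
def multSum (lam : ℕ → ℕ) (k' s : ℕ) : ℕ := ∑ t ∈ Finset.range (s + 1), multVal lam k' t

/-- `I_s = {(k_0+⋯+k_{s-1})/2 + 1, …, (k_0+⋯+k_s)/2}` for `s ≥ 1`. -/
def indexSet (lam : ℕ → ℕ) (k' s : ℕ) : Finset ℕ :=
  Finset.Icc (multSum lam k' (s - 1) / 2 + 1) (multSum lam k' s / 2)

/-- `ν_i = (λ_1 + ⋯ + λ_i) / 2`. -/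
def nuVal (lam : ℕ → ℕ) (i : ℕ) : ℕ := (∑ t ∈ Finset.Icc 1 i, lam t) / 2

/-! ### Polynomial functions and initial homogeneous components -/

section PolynomialFunctions

variable {𝕜 : Type*} [Field 𝕜] {W : Type*} [AddCommGroup W] [Module 𝕜 W]

/-- Polynomial functions on `W`: the algebra of functions generated by the linear forms. -/
def IsPolynomialFunction (F : W → 𝕜) : Prop :=
  F ∈ Algebra.adjoin 𝕜 (Set.range fun φ : Module.Dual 𝕜 W => (fun x => φ x : W → 𝕜))

open Classical in
/-- The homogeneous component of degree `n` of a polynomial function `F` (over an infinite field):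
its value at `x` is the coefficient of `t ^ n` in the polynomial `t ↦ F (t x)`. -/
noncomputable def homComponent (F : W → 𝕜) (n : ℕ) : W → 𝕜 := fun x =>
  if h : ∃ P : 𝕜[X], ∀ t : 𝕜, P.eval t = F (t • x) then (Classical.choose h).coeff n else 0

/-- The initial homogeneous component of a polynomial function: its nonzero homogeneous component
of least degree (and `0` for the zero function). -/
noncomputable def initialComponent (F : W → 𝕜) : W → 𝕜 :=
  homComponent F (sInf {n | homComponent F n ≠ 0})

end PolynomialFunctions

/-! ### The Lie algebra `𝔤 = 𝔰𝔬(V)`, an `𝔰𝔩₂`-triple and the decomposition of `V` -/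

section Orthogonal

variable {𝕜 : Type*} [Field 𝕜] {V : Type*} [AddCommGroup V] [Module 𝕜 V]
  {B : LinearMap.BilinForm 𝕜 V}

/-- The subalgebra `𝔰` generated by `e`, `h`, `f`. -/
abbrev tripleSpan (e h f : skewAdjointLieSubalgebra B) :
    LieSubalgebra 𝕜 (skewAdjointLieSubalgebra B) :=
  LieSubalgebra.lieSpan 𝕜 (skewAdjointLieSubalgebra B) {e, h, f}

/-- The subspaces of `V` underlying a family of `𝔰`-submodules. -/
abbrev asSubspaces {e h f : skewAdjointLieSubalgebra B}
    (U : ℕ → LieSubmodule 𝕜 (tripleSpan e h f) V) : ℕ → Submodule 𝕜 V :=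
  fun j => (U j : Submodule 𝕜 V)

/-- The centralizer `𝔤^f`. -/
abbrev centralizerOf (f : skewAdjointLieSubalgebra B) :
    Submodule 𝕜 (skewAdjointLieSubalgebra B) :=
  LinearMap.ker (LieAlgebra.ad 𝕜 (skewAdjointLieSubalgebra B) f)

/-- `V[0] = V_{k'+1} + ⋯ + V_k` and `V[i] = V_{2i-1} + V_{2i}` for `i ≥ 1`. -/
def blockSpace (U : ℕ → Submodule 𝕜 V) (k k' i : ℕ) : Submodule 𝕜 V :=
  if i = 0 then ⨆ j ∈ Finset.Icc (k' + 1) k, U j else U (2 * i - 1) ⊔ U (2 * i)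

/-- `V = V_1 ⊕ ⋯ ⊕ V_k` is a decomposition into simple `𝔰`-modules of dimensions
`λ_1 ≥ ⋯ ≥ λ_k` (so that `λ` is the partition of `dim V` attached to `e`), ordered in such a way
that the subspaces `V[0], V[1], …, V[k'/2]` are pairwise orthogonal. -/
structure IsAdaptedDecomposition (e h f : skewAdjointLieSubalgebra B) (lam : ℕ → ℕ) (k k' : ℕ)
    (U : ℕ → LieSubmodule 𝕜 (tripleSpan e h f) V) : Prop where
  irreducible : ∀ j ∈ Finset.Icc 1 k, LieModule.IsIrreducible 𝕜 (tripleSpan e h f) (U j)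
  indep : iSupIndep fun j : Finset.Icc 1 k => (U j : Submodule 𝕜 V)
  span : ⨆ j ∈ Finset.Icc 1 k, (U j : Submodule 𝕜 V) = ⊤
  finrank_eq : ∀ j ∈ Finset.Icc 1 k, Module.finrank 𝕜 (U j) = lam j
  anti : ∀ i j, 1 ≤ i → i ≤ j → j ≤ k → lam j ≤ lam i
  orthogonal : ∀ i ≤ k' / 2, ∀ j ≤ k' / 2, i ≠ j →
    ∀ v ∈ blockSpace (asSubspaces U) k k' i,
    ∀ w ∈ blockSpace (asSubspaces U) k k' j, B v w = 0

open Classical in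
/-- The projection of `V = V_1 ⊕ ⋯ ⊕ V_k` onto `V_j` along the other summands. -/
noncomputable def summandProj (U : ℕ → Submodule 𝕜 V) (k j : ℕ) : Module.End 𝕜 V :=
  if hc : IsCompl (U j) (⨆ l ∈ (Finset.Icc 1 k).erase j, U l) then Submodule.projection (U j) _ hc else 0

/-- For an adapted decomposition the complementarity in the definition of the projection holds. -/
theorem IsAdaptedDecomposition.isCompl {e h f : skewAdjointLieSubalgebra B} {lam : ℕ → ℕ}
    {k k' : ℕ} {U : ℕ → LieSubmodule 𝕜 (tripleSpan e h f) V}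
    (hU : IsAdaptedDecomposition e h f lam k k' U) {j : ℕ} (hj : j ∈ Finset.Icc 1 k) :
    IsCompl (U j : Submodule 𝕜 V)
      (⨆ l ∈ (Finset.Icc 1 k).erase j, (U l : Submodule 𝕜 V)) := by
  constructor
  · have := hU.indep ⟨j, hj⟩
    refine this.mono_right ?_
    refine iSup₂_le fun l hl => ?_
    rw [Finset.mem_erase] at hl
    exact le_iSup₂_of_le (f := fun (i : Finset.Icc 1 k) (_ : i ≠ ⟨j, hj⟩) =>
      (U i : Submodule 𝕜 V)) ⟨l, hl.2⟩ (fun h => hl.1 (congrArg Subtype.val h)) le_rfl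
  · rw [codisjoint_iff, eq_top_iff, ← hU.span]
    refine iSup₂_le fun l hl => ?_
    by_cases hlj : l = j
    · subst hlj; exact le_sup_left
    · exact le_sup_of_le_right (le_iSup₂_of_le (f := fun (i : ℕ)
        (_ : i ∈ (Finset.Icc 1 k).erase j) => (U i : Submodule 𝕜 V)) l
        (Finset.mem_erase.2 ⟨hlj, hl⟩) le_rfl)

/-- `ε_j = (e|_{V_j}) ^ (λ_j - 1)`, extended by zero on the other summands. -/
noncomputable def epsEnd (e : skewAdjointLieSubalgebra B) (lam : ℕ → ℕ) (k : ℕ)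
    (U : ℕ → Submodule 𝕜 V) (j : ℕ) : Module.End 𝕜 V :=
  (e : Module.End 𝕜 V) ^ (lam j - 1) * summandProj U k j

/-- `z_l = ε_{2l-1} + ε_{2l}`. -/
noncomputable def zEnd (e : skewAdjointLieSubalgebra B) (lam : ℕ → ℕ) (k : ℕ)
    (U : ℕ → Submodule 𝕜 V) (l : ℕ) : Module.End 𝕜 V :=
  epsEnd e lam k U (2 * l - 1) + epsEnd e lam k U (2 * l)

/-- The subspace `𝔤̄ = 𝔰𝔬(V[0]) ⊕ 𝔰𝔬(V[1]) ⊕ ⋯ ⊕ 𝔰𝔬(V[k'/2])` of `𝔤`: the skew-adjoint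
endomorphisms that preserve every `V[i]`. -/
def gBar (B : LinearMap.BilinForm 𝕜 V) (U : ℕ → Submodule 𝕜 V) (k k' : ℕ) :
    Submodule 𝕜 (skewAdjointLieSubalgebra B) where
  carrier := {x | ∀ i ≤ k' / 2, ∀ v ∈ blockSpace U k k' i,
    (x : Module.End 𝕜 V) v ∈ blockSpace U k k' i}
  add_mem' := fun ha hb i hi v hv => Submodule.add_mem _ (ha i hi v hv) (hb i hi v hv)
  zero_mem' := fun _ _ _ _ => Submodule.zero_mem _
  smul_mem' := fun c _ ha i hi v hv => Submodule.smul_mem _ c (ha i hi v hv)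

/-- The centralizer `𝔤̄^f` of `f` in `𝔤̄`. -/
abbrev gBarCentralizer (f : skewAdjointLieSubalgebra B) (U : ℕ → Submodule 𝕜 V) (k k' : ℕ) :
    Submodule 𝕜 (skewAdjointLieSubalgebra B) :=
  centralizerOf f ⊓ gBar B U k k'

/-- `z_l`, as a linear function on `𝔤̄^f`, for the invariant form `(x, y) ↦ tr (x y) / 2`. -/
noncomputable def zFun (e f : skewAdjointLieSubalgebra B) (lam : ℕ → ℕ) (k k' : ℕ)
    (U : ℕ → Submodule 𝕜 V) (l : ℕ) : gBarCentralizer f U k k' → 𝕜 := fun y =>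
  LinearMap.trace 𝕜 V (zEnd e lam k U l * ((y : skewAdjointLieSubalgebra B) : Module.End 𝕜 V)) / 2

/-- `σ^{(s)}_r`: the elementary symmetric function of degree `r` in the `z_l`, `l ∈ I_s`. -/
noncomputable def sigmaFun (e f : skewAdjointLieSubalgebra B) (lam : ℕ → ℕ) (k k' : ℕ)
    (U : ℕ → Submodule 𝕜 V) (s r : ℕ) : gBarCentralizer f U k k' → 𝕜 :=
  ∑ t ∈ (indexSet lam k' s).powersetCard r, ∏ l ∈ t, zFun e f lam k k' U l

/-! ### The invariants `q_i` and the polynomials `p_i` -/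

/-- `Q_i(x)`, the coefficient of degree `dim V - i` of the characteristic polynomial of `x`. -/
noncomputable def charCoeff [FiniteDimensional 𝕜 V] (i : ℕ) (x : skewAdjointLieSubalgebra B) : 𝕜 :=
  (LinearMap.charpoly (x : Module.End 𝕜 V)).coeff (Module.finrank 𝕜 V - i)

/-- The generators `q_i`: `q_i = Q_{2i}`, except that `q_ℓ` is the given function `pf` (a square
root of `Q_{2ℓ}`) if `dim V = 2ℓ`. -/
noncomputable def qInv [FiniteDimensional 𝕜 V] (ℓ : ℕ) (pf : skewAdjointLieSubalgebra B → 𝕜)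
    (i : ℕ) : skewAdjointLieSubalgebra B → 𝕜 :=
  if Module.finrank 𝕜 V = 2 * ℓ ∧ i = ℓ then pf else charCoeff (2 * i)

/-- The initial homogeneous component of the function `x ↦ q(e + x)` on `𝔤^f`. -/
noncomputable def initialOnSlice (e f : skewAdjointLieSubalgebra B)
    (q : skewAdjointLieSubalgebra B → 𝕜) : centralizerOf f → 𝕜 :=
  initialComponent fun x : centralizerOf f => q (e + x)

/-- The polynomials `p_i`, `1 ≤ i ≤ k'`, with `p_0 = 1`. -/
noncomputable def pPoly [FiniteDimensional 𝕜 V] (e f : skewAdjointLieSubalgebra B) (ℓ : ℕ)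
    (pf : skewAdjointLieSubalgebra B → 𝕜) (lam : ℕ → ℕ) (k k' i : ℕ) : centralizerOf f → 𝕜 :=
  if i = 0 then 1
  else if k' = k ∧ i = k then initialOnSlice e f (qInv ℓ pf (nuVal lam i)) ^ 2
  else initialOnSlice e f (qInv ℓ pf (nuVal lam i))

/-- The restriction `p̄_i` of `p_i` to `𝔤̄^f`. -/
noncomputable def pBar [FiniteDimensional 𝕜 V] (e f : skewAdjointLieSubalgebra B) (ℓ : ℕ)
    (pf : skewAdjointLieSubalgebra B → 𝕜) (lam : ℕ → ℕ) (k k' : ℕ) (U : ℕ → Submodule 𝕜 V)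
    (i : ℕ) : gBarCentralizer f U k k' → 𝕜 := fun y =>
  pPoly e f ℓ pf lam k k' i ⟨y, y.2.1⟩

end Orthogonal

/-! Choose chain bases `v_j, e v_j, …, e^(λ_j - 1) v_j` of the simple summands. Then `e` becomes a
shift matrix `E`; let `Y` be the matrix of `y ∈ 𝔤^f`. Everything is read off from the Newton polygon
of `det (X - E - t Y)`.

Substitute `t = X^c u`. Replacing the last vector of the chain `j` by `∑ X^(λ_j - 1 - a) v_a` turns
the corresponding column of `X - E` into `X^(λ_j)` times the first basis vector of the chain, so in
the full matrix this column is divisible by `X^min(λ_j, c)`. Hence the determinant is divisible by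
`X^(∑ min(λ_j, c))`. At `X = 0` the quotient is the determinant of a `k × k` matrix, `chainCorner`,
which only sees the entries of `Y` from the end of a chain to the start of a chain
(`exists_det_eq_pow_mul`). For `c = λ_i` with `i ≤ k'` one has `dim V - 2 ν_i + i λ_i = ∑ min(λ_j,
λ_i)`. So `Q_{2ν_i}(e + t y)` has no term in `t^n` for `n < i`, and its term in `t^i` is the
coefficient of `u^i` in the small determinant (`IsChainBasis.homComponent_charCoeff`).

On `𝔤̄^f` the small matrix is diagonal. The columns `j > k'` are those of the identity, because `λ_j
< c`. In the others, `y` preserves the blocks `V[l]`, and inside a block `B (y w) w = 0` kills the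
two off-diagonal entries, while skew-adjointness makes the two diagonal entries equal; their common
value is `z_l`. For `c = μ_s` the determinant is therefore `u^(k_0 + ⋯ + k_{s-1})` times the square
of the product of the earlier `z_l` times `(∏_{l ∈ I_s} (1 - u z_l))^2`. Expanding the last square
gives the formula.

It remains to see that the component of degree `i` is the initial one, i.e. nonzero: at an element
with all `z_l = 1` the last factor is `(1 - u)^(k_s)`, which has no vanishing coefficient in degrees
up to `k_s`. If `i = k = k'`, the invariant is a square root of `Q_{dim V}`, and the square of its
initial component is the initial component of its square (`initialComponent_sq`).

The condition `(∗)` enters through `λ_{2l-1} = λ_{2l}` for `2l ≤ k'` and `λ_{k'+1} < λ_{k'}`. A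
nonempty very good sequence starts with an odd entry (`IsVeryGood.odd_one`), so no value of the head
recurs in the tail, and even values have even multiplicity because odd powers of `e` have even rank
(`IsChainBasis.even_multiplicity`). -/

/-! ### Determinants of perturbed shift matrices -/

section ChainMatrices

variable {J : Type*} [Fintype J] [DecidableEq J] (d : J → ℕ)

/-- The matrix of the nilpotent endomorphism with Jordan chains of lengths `d j`. -/
def chainShift (R : Type*) [CommRing R] : Matrix (Σ j, Fin (d j)) (Σ j, Fin (d j)) R :=
  Matrix.of fun p q => if p.1 = q.1 ∧ (p.2 : ℕ) = q.2 + 1 then 1 else 0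

variable {d}

/-- The last position of a chain. -/
def IsChainTop (p : Σ j, Fin (d j)) : Prop := (p.2 : ℕ) + 1 = d p.1

instance (p : Σ j, Fin (d j)) : Decidable (IsChainTop p) :=
  inferInstanceAs (Decidable ((p.2 : ℕ) + 1 = d p.1))

/-- The first position of a chain. -/
def chainBot (hd : ∀ j, 0 < d j) (j : J) : Σ j, Fin (d j) := ⟨j, ⟨0, hd j⟩⟩

/-- The last position of a chain. -/
def chainTop (hd : ∀ j, 0 < d j) (j : J) : Σ j, Fin (d j) :=
  ⟨j, ⟨d j - 1, Nat.sub_lt (hd j) one_pos⟩⟩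

omit [Fintype J] [DecidableEq J] in
theorem chain_ext {p q : Σ j, Fin (d j)} (h1 : p.1 = q.1) (h2 : (p.2 : ℕ) = q.2) : p = q := by
  obtain ⟨i, a⟩ := p
  obtain ⟨j, b⟩ := q
  obtain rfl : i = j := h1
  exact congrArg _ (Fin.ext h2)

omit [Fintype J] [DecidableEq J] in
theorem isChainTop_chainTop (hd : ∀ j, 0 < d j) (j : J) : IsChainTop (chainTop hd j) := by
  have := hd j
  simp [IsChainTop, chainTop]; omega

omit [Fintype J] [DecidableEq J] in
theorem eq_chainTop (hd : ∀ j, 0 < d j) {p : Σ j, Fin (d j)} (hp : IsChainTop p) :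
    p = chainTop hd p.1 := by
  refine chain_ext rfl ?_
  have : (p.2 : ℕ) + 1 = d p.1 := hp
  simp only [chainTop]; omega

variable (d) in
/-- The column operations that replace the last vector `v_{d-1}` of every chain by
`∑ x ^ (d - 1 - a) v_a`. -/
def chainColOp {R : Type*} [CommRing R] (x : R) : Matrix (Σ j, Fin (d j)) (Σ j, Fin (d j)) R :=
  Matrix.of fun p q =>
    if IsChainTop q then (if p.1 = q.1 then x ^ (d q.1 - 1 - p.2) else 0)
    else if p = q then 1 else 0

/-- All columns outside the chain ends are unit vectors, so the matrix is block triangular with an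
identity block, and only the block indexed by the chain ends contributes. -/
theorem det_of_topBlock {R : Type*} [CommRing R] (hd : ∀ j, 0 < d j)
    (M : Matrix (Σ j, Fin (d j)) (Σ j, Fin (d j)) R)
    (hM : ∀ p q, ¬ IsChainTop q → M p q = if p = q then 1 else 0) :
    M.det = (Matrix.of fun i j => M (chainTop hd i) (chainTop hd j)).det := by
  rw [Matrix.twoBlockTriangular_det M (fun p => ¬ IsChainTop p)]
  · have h1 : M.toSquareBlockProp (fun p => ¬ IsChainTop p) = 1 := by
      ext p q
      simp only [Matrix.toSquareBlockProp_def, Matrix.of_apply]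
      rw [hM _ _ q.2, Matrix.one_apply]
      simp only [Subtype.ext_iff]
    rw [h1, Matrix.det_one, one_mul]
    let φ : J ≃ {p : Σ j, Fin (d j) // ¬ ¬ IsChainTop p} :=
      { toFun := fun j => ⟨chainTop hd j, not_not.2 (isChainTop_chainTop hd j)⟩
        invFun := fun p => p.1.1
        left_inv := fun j => rfl
        right_inv := fun p => Subtype.ext (eq_chainTop hd (not_not.1 p.2)).symm }
    rw [← Matrix.det_submatrix_equiv_self φ]
    rfl
  · intro p hp q hq
    rw [hM _ _ hq, if_neg]
    rintro rfl
    exact hp hq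

theorem det_chainColOp {R : Type*} [CommRing R] (hd : ∀ j, 0 < d j) (x : R) :
    (chainColOp d x).det = 1 := by
  rw [det_of_topBlock hd]
  · rw [← Matrix.det_one (n := J) (R := R)]
    congr 1
    ext i j
    simp only [chainColOp, Matrix.of_apply, if_pos (isChainTop_chainTop hd j)]
    by_cases h : i = j
    · subst h
      simp [chainTop]
    · simp [chainTop, h]
  · intro p q hq
    simp [chainColOp, hq]

/-- Telescoping: `x - E` applied to `∑ x^(d-1-a) v_a` leaves only `x^d v_0`. -/
theorem sub_chainShift_mul_chainColOp {R : Type*} [CommRing R] (x : R)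
    {p q : Σ j, Fin (d j)} (hq : IsChainTop q) :
    ((x • (1 : Matrix (Σ j, Fin (d j)) (Σ j, Fin (d j)) R) - chainShift d R) * chainColOp d x) p q =
      if p.1 = q.1 ∧ (p.2 : ℕ) = 0 then x ^ d q.1 else 0 := by
  have hE : (chainShift d R * chainColOp d x) p q =
      if p.1 = q.1 ∧ (p.2 : ℕ) ≠ 0 then x ^ (d q.1 - p.2) else 0 := by
    rw [Matrix.mul_apply]
    by_cases h0 : (p.2 : ℕ) = 0
    · rw [if_neg (by tauto)]
      refine Finset.sum_eq_zero fun r _ => ?_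
      simp only [chainShift, Matrix.of_apply]
      rw [if_neg (by omega), zero_mul]
    · have hp := p.2.2
      rw [Finset.sum_eq_single (⟨p.1, ⟨p.2 - 1, by omega⟩⟩ : Σ j, Fin (d j))]
      · simp only [chainShift, chainColOp, Matrix.of_apply, if_pos hq]
        rw [if_pos ⟨trivial, by omega⟩, one_mul]
        by_cases h1 : p.1 = q.1
        · rw [if_pos h1, if_pos ⟨h1, h0⟩]
          congr 1
          have h3 := congrArg d h1
          omega
        · rw [if_neg h1, if_neg (by tauto)]
      · intro r _ hr
        simp only [chainShift, Matrix.of_apply]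
        rw [if_neg, zero_mul]
        rintro ⟨h1, h2⟩
        refine hr (chain_ext h1.symm ?_)
        simp only; omega
      · simp
  rw [sub_mul, Matrix.sub_apply, hE, smul_mul_assoc, one_mul, Matrix.smul_apply]
  simp only [chainColOp, Matrix.of_apply, if_pos hq, smul_eq_mul]
  by_cases h1 : p.1 = q.1
  · have hp := p.2.2
    have h3 := congrArg d h1
    by_cases h0 : (p.2 : ℕ) = 0
    · simp only [h1, h0, ne_eq, not_true, and_false, if_false, if_true, and_true, sub_zero]
      rw [← pow_succ']
      congr 1; omega
    · simp only [h1, h0, ne_eq, not_false_eq_true, and_true, if_true, and_false, if_false]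
      rw [← pow_succ', sub_eq_zero]
      congr 1; omega
  · simp [h1]

variable {S : Type*} [CommRing S]

theorem det_smul_one_sub_chainShift {R : Type*} [CommRing R] (x : R) :
    (x • (1 : Matrix (Σ j, Fin (d j)) (Σ j, Fin (d j)) R) - chainShift d R).det =
      x ^ ∑ j, d j := by
  -- The shift raises the position in a chain, so the matrix is lower triangular for the position;
  -- hence the dual order.
  have hT : Matrix.BlockTriangular
      (x • (1 : Matrix (Σ j, Fin (d j)) (Σ j, Fin (d j)) R) - chainShift d R)
      (fun p => OrderDual.toDual (p.2 : ℕ)) := by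
    intro p q hpq
    have h : (p.2 : ℕ) < q.2 := hpq
    have h1 : p ≠ q := by rintro rfl; exact lt_irrefl _ h
    simp only [Matrix.sub_apply, Matrix.smul_apply, Matrix.one_apply_ne h1, smul_zero, chainShift,
      Matrix.of_apply, zero_sub, neg_eq_zero]
    rw [if_neg]
    omega
  rw [hT.det]
  have hB : ∀ a, ((x • (1 : Matrix (Σ j, Fin (d j)) (Σ j, Fin (d j)) R) -
      chainShift d R).toSquareBlock (fun p => OrderDual.toDual (p.2 : ℕ)) a) = x • 1 := by
    intro a
    ext p q
    simp only [Matrix.toSquareBlock_def, Matrix.of_apply, Matrix.sub_apply, Matrix.smul_apply,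
      Matrix.one_apply, chainShift, Subtype.ext_iff]
    have h : (p.1.2 : ℕ) = q.1.2 := OrderDual.toDual.injective (p.2.trans q.2.symm)
    rw [if_neg (c := _ ∧ _) (by omega), sub_zero]
  simp only [hB, Matrix.det_smul, Matrix.det_one, mul_one]
  rw [Finset.prod_pow_eq_pow_sum]
  congr 1
  have h2 : ∑ j, d j = (Finset.univ : Finset (Σ j, Fin (d j))).card := by
    rw [Finset.card_univ, Fintype.card_sigma]; simp
  rw [h2, Finset.card_eq_sum_card_image (fun p : Σ j, Fin (d j) => OrderDual.toDual (p.2 : ℕ))]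
  refine Finset.sum_congr rfl fun a _ => ?_
  rw [Fintype.card_subtype]

variable (d) in
/-- The signed cyclic permutation matrix `v_a ↦ -v_{a+1}`, `v_{d-1} ↦ v_0` (plus `x` on the
positions that are not last). -/
def chainCycle {R : Type*} [CommRing R] (x : R) : Matrix (Σ j, Fin (d j)) (Σ j, Fin (d j)) R :=
  Matrix.of fun p q =>
    if IsChainTop q then (if p.1 = q.1 ∧ (p.2 : ℕ) = 0 then 1 else 0)
    else (x • (1 : Matrix (Σ j, Fin (d j)) (Σ j, Fin (d j)) R) - chainShift d R) p q

theorem mul_chainColOp_apply_of_not_isChainTop {R : Type*} [CommRing R] (x : R)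
    (M : Matrix (Σ j, Fin (d j)) (Σ j, Fin (d j)) R)
    {p q : Σ j, Fin (d j)} (hq : ¬ IsChainTop q) : (M * chainColOp d x) p q = M p q := by
  rw [Matrix.mul_apply, Finset.sum_eq_single q]
  · simp [chainColOp, hq]
  · intro r _ hr
    simp [chainColOp, hq, hr]
  · simp

omit [DecidableEq J] in
theorem prod_ite_isChainTop {R : Type*} [CommRing R] (hd : ∀ j, 0 < d j) (g : J → R) :
    (∏ q : Σ j, Fin (d j), if IsChainTop q then g q.1 else 1) = ∏ j, g j := by
  rw [Fintype.prod_sigma]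
  refine Finset.prod_congr rfl fun j _ => ?_
  rw [Fintype.prod_eq_single (⟨d j - 1, Nat.sub_lt (hd j) one_pos⟩ : Fin (d j))]
  · exact if_pos (isChainTop_chainTop hd j)
  · intro b hb
    rw [if_neg]
    intro h
    refine hb (Fin.ext ?_)
    have h' : (b : ℕ) + 1 = d j := h
    simp only; omega

/-- The signs `-1` in the cycle cancel the sign of the cyclic permutation. Instead of computing
signs, one works over `S[X]`: the column operation factors `X - E` as `chainCycle d X` times a
diagonal matrix of determinant `X^(∑ d_j) = det (X - E)`. This factor is cancelled, and `X` is set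
to `0`. -/
theorem det_chainCycle_zero [IsDomain S] (hd : ∀ j, 0 < d j) :
    (chainCycle d (0 : S)).det = 1 := by
  have h1 : (chainCycle d (X : S[X])).det = 1 := by
    have h : ((X : S[X]) • (1 : Matrix (Σ j, Fin (d j)) (Σ j, Fin (d j)) S[X]) -
        chainShift d S[X]) * chainColOp d X =
        chainCycle d X * Matrix.diagonal fun q => if IsChainTop q then X ^ d q.1 else 1 := by
      ext1 p q
      rw [Matrix.mul_diagonal]
      by_cases hq : IsChainTop q
      · rw [sub_chainShift_mul_chainColOp _ hq]
        simp [chainCycle, hq]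
      · rw [mul_chainColOp_apply_of_not_isChainTop _ _ hq]
        simp [chainCycle, hq]
    have h2 := congrArg Matrix.det h
    rw [Matrix.det_mul, Matrix.det_mul, det_chainColOp hd, det_smul_one_sub_chainShift,
      Matrix.det_diagonal, mul_one] at h2
    have h3 : (∏ q : Σ j, Fin (d j), if IsChainTop q then (X : S[X]) ^ d q.1 else 1) =
        X ^ ∑ j, d j := by
      rw [← Finset.prod_pow_eq_pow_sum]
      exact prod_ite_isChainTop hd fun j => (X : S[X]) ^ d j
    rw [h3] at h2
    have h4 : (X : S[X]) ^ ∑ j, d j ≠ 0 := pow_ne_zero _ X_ne_zero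
    exact (mul_right_cancel₀ h4 (by rw [one_mul]; exact h2)).symm
  have h2 := congrArg (Polynomial.evalRingHom (0 : S)) h1
  rw [RingHom.map_det, map_one] at h2
  rw [← h2]
  congr 1
  ext1 p q
  simp only [chainCycle, RingHom.mapMatrix_apply, Matrix.map_apply, Matrix.of_apply,
    Matrix.sub_apply, Matrix.smul_apply, Matrix.one_apply, chainShift]
  split_ifs <;> simp

/-- The matrix that governs the leading behaviour of `det (X - E - X ^ c u Y)`. -/
def chainCorner (hd : ∀ j, 0 < d j) (c : ℕ) (u : S)
    (Y : Matrix (Σ j, Fin (d j)) (Σ j, Fin (d j)) S) : Matrix J J S :=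
  Matrix.of fun i j => (if d j ≤ c ∧ i = j then 1 else 0) -
    (if c ≤ d j then u * Y (chainBot hd i) (chainTop hd j) else 0)

/-- The determinant with `t = X^c u` has an explicit power of `X` as a factor; the cofactor at `X =
0` is the edge polynomial of the Newton polygon for the slope `c`. -/
theorem exists_det_eq_pow_mul [IsDomain S] (hd : ∀ j, 0 < d j) {c : ℕ} (hc : 0 < c) (u : S)
    (Y : Matrix (Σ j, Fin (d j)) (Σ j, Fin (d j)) S) :
    ∃ H : S[X], ((X : S[X]) • (1 : Matrix (Σ j, Fin (d j)) (Σ j, Fin (d j)) S[X]) -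
        chainShift d S[X] - (X ^ c * C u) • Y.map C).det = X ^ (∑ j, min (d j) c) * H ∧
      H.coeff 0 = (chainCorner hd c u Y).det := by
  -- The matrix after the column operation, with the last column of each chain divided by `X^min(d,
  -- c)`. Both remaining exponents are honest differences, and at `X = 0` the first term survives
  -- exactly for `d ≤ c`, the second exactly for `c ≤ d`.
  let N : Matrix (Σ j, Fin (d j)) (Σ j, Fin (d j)) S[X] := Matrix.of fun p q =>
    if IsChainTop q then
      X ^ (d q.1 - min (d q.1) c) * (if p.1 = q.1 ∧ (p.2 : ℕ) = 0 then 1 else 0) -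
        X ^ (c - min (d q.1) c) * C u *
          (Y.map C * chainColOp d X : Matrix (Σ j, Fin (d j)) (Σ j, Fin (d j)) S[X]) p q
    else ((X : S[X]) • (1 : Matrix (Σ j, Fin (d j)) (Σ j, Fin (d j)) S[X]) -
        chainShift d S[X] - (X ^ c * C u) • Y.map C) p q
  refine ⟨N.det, ?_, ?_⟩
  · have h : ((X : S[X]) • (1 : Matrix (Σ j, Fin (d j)) (Σ j, Fin (d j)) S[X]) -
        chainShift d S[X] - (X ^ c * C u) • Y.map C) * chainColOp d X =
        N * Matrix.diagonal fun q => if IsChainTop q then X ^ min (d q.1) c else 1 := by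
      ext1 p q
      rw [Matrix.mul_diagonal]
      by_cases hq : IsChainTop q
      · rw [sub_mul, Matrix.sub_apply, sub_chainShift_mul_chainColOp _ hq, smul_mul_assoc,
          Matrix.smul_apply]
        simp only [N, Matrix.of_apply, if_pos hq]
        have e1 : (X : S[X]) ^ d q.1 = X ^ (d q.1 - min (d q.1) c) * X ^ min (d q.1) c := by
          rw [← pow_add]; congr 1; omega
        have e2 : (X : S[X]) ^ c = X ^ (c - min (d q.1) c) * X ^ min (d q.1) c := by
          rw [← pow_add]; congr 1; omega
        rw [smul_eq_mul, e2]
        split_ifs with h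
        · rw [e1]; ring
        · ring
      · rw [mul_chainColOp_apply_of_not_isChainTop _ _ hq]
        simp [N, hq]
    have h2 := congrArg Matrix.det h
    rw [Matrix.det_mul, Matrix.det_mul, det_chainColOp hd, Matrix.det_diagonal, mul_one] at h2
    have h3 : (∏ q : Σ j, Fin (d j), if IsChainTop q then (X : S[X]) ^ min (d q.1) c else 1) =
        X ^ ∑ j, min (d j) c := by
      rw [← Finset.prod_pow_eq_pow_sum]
      exact prod_ite_isChainTop hd fun j => (X : S[X]) ^ min (d j) c
    rw [h2, h3, mul_comm]
  -- At `X = 0` the columns of `N` that are not last become those of `chainCycle d 0`, which maps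
  -- `v_a` to `-v_{a+1}` and a chain end to its chain start. `K'` is what remains after factoring
  -- this cycle out; its rows at chain ends therefore read the entries of `Y` at chain starts.
  · let K' : Matrix (Σ j, Fin (d j)) (Σ j, Fin (d j)) S := Matrix.of fun p q =>
      if IsChainTop q then
        (if h : (p.2 : ℕ) + 1 < d p.1 then
          (if c ≤ d q.1 then u * Y ⟨p.1, ⟨p.2 + 1, h⟩⟩ q else 0)
        else chainCorner hd c u Y p.1 q.1)
      else if p = q then 1 else 0
    have hN : (Polynomial.evalRingHom (0 : S)).mapMatrix N = chainCycle d (0 : S) * K' := by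
      ext1 p q
      by_cases hq : IsChainTop q
      · have hq' := eq_chainTop hd hq
        have hYC : eval 0
            ((Y.map C * chainColOp d X : Matrix (Σ j, Fin (d j)) (Σ j, Fin (d j)) S[X]) p q) =
            Y p q := by
          rw [Matrix.mul_apply, eval_finsetSum, Finset.sum_eq_single q]
          · have : (q.2 : ℕ) + 1 = d q.1 := hq
            simp only [Matrix.map_apply, chainColOp, Matrix.of_apply, if_pos hq, if_true, eval_mul,
              eval_C]
            rw [show d q.1 - 1 - (q.2 : ℕ) = 0 by omega]
            simp
          · intro r _ hr
            simp only [Matrix.map_apply, chainColOp, Matrix.of_apply, if_pos hq, eval_mul]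
            split_ifs with h
            · have h1 : (q.2 : ℕ) + 1 = d q.1 := hq
              have h2 : (r.2 : ℕ) ≠ q.2 := fun h2 => hr (chain_ext h h2)
              have h3 := r.2.2
              have h4 := congrArg d h
              rw [eval_pow, eval_X, zero_pow (by omega), mul_zero]
            · simp
          · simp
        have hL : (Polynomial.evalRingHom (0 : S)).mapMatrix N p q =
            (if d q.1 ≤ c ∧ p.1 = q.1 ∧ (p.2 : ℕ) = 0 then 1 else 0) -
              (if c ≤ d q.1 then u * Y p q else 0) := by
          simp only [N, RingHom.mapMatrix_apply, Matrix.map_apply, Matrix.of_apply, if_pos hq,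
            coe_evalRingHom, eval_sub, eval_mul, hYC, eval_pow, eval_X, eval_C]
          congr 1
          · by_cases h1 : d q.1 ≤ c
            · simp [h1]
              split_ifs <;> simp
            · rw [zero_pow (by omega), zero_mul, if_neg (by tauto)]
          · by_cases h1 : c ≤ d q.1
            · simp [h1]
            · rw [zero_pow (by omega), if_neg h1, zero_mul, zero_mul]
        rw [hL, Matrix.mul_apply]
        by_cases h0 : (p.2 : ℕ) = 0
        · have hp : p = chainBot hd p.1 := chain_ext rfl h0
          rw [Finset.sum_eq_single (chainTop hd p.1)]
          · simp only [chainCycle, Matrix.of_apply, if_pos (isChainTop_chainTop hd p.1), K',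
              if_pos hq]
            have h2 := isChainTop_chainTop hd p.1
            rw [if_pos (c := p.1 = (chainTop hd p.1).1 ∧ _) ⟨rfl, h0⟩, one_mul,
              dif_neg (not_lt.2 (by exact h2.ge))]
            simp only [chainCorner, Matrix.of_apply]
            rw [← hq', show (chainTop hd p.1).1 = p.1 from rfl, ← hp]
            simp [h0]
          · intro r _ hr
            simp only [chainCycle, Matrix.of_apply]
            split_ifs with h1 h2
            · refine absurd ?_ hr
              rw [h2.1]
              exact eq_chainTop hd h1
            · rw [zero_mul]
            · simp only [zero_smul, zero_sub, Matrix.neg_apply, chainShift, Matrix.of_apply]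
              rw [if_neg (by omega)]; simp
          · simp
        · have hp := p.2.2
          rw [Finset.sum_eq_single (⟨p.1, ⟨p.2 - 1, by omega⟩⟩ : Σ j, Fin (d j))]
          · simp only [chainCycle, Matrix.of_apply, K', if_pos hq]
            rw [if_neg (c := d q.1 ≤ c ∧ _) (by tauto),
              if_neg (c := IsChainTop _) (by simp only [IsChainTop]; omega), dif_pos (by omega)]
            simp only [zero_smul, zero_sub, Matrix.neg_apply, chainShift, Matrix.of_apply]
            rw [if_pos (c := True ∧ (p.2 : ℕ) = p.2 - 1 + 1) ⟨trivial, by omega⟩]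
            have : (⟨p.1, ⟨(p.2 : ℕ) - 1 + 1, by omega⟩⟩ : Σ j, Fin (d j)) = p :=
              chain_ext rfl (by simp only; omega)
            rw [this]
            ring
          · intro r _ hr
            simp only [chainCycle, Matrix.of_apply]
            rw [if_neg (c := p.1 = r.1 ∧ (p.2 : ℕ) = 0) (by tauto)]
            simp only [zero_smul, zero_sub, Matrix.neg_apply, chainShift, Matrix.of_apply]
            rw [if_neg (c := p.1 = r.1 ∧ _)]
            · simp
            · rintro ⟨h1, h2⟩
              refine hr (chain_ext h1.symm ?_)
              simp only; omega
          · simp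
      · rw [Matrix.mul_apply, Finset.sum_eq_single q]
        · simp only [N, K', RingHom.mapMatrix_apply, Matrix.map_apply, Matrix.of_apply, if_neg hq,
            if_true, mul_one, chainCycle, coe_evalRingHom, Matrix.sub_apply, Matrix.smul_apply,
            chainShift, Matrix.one_apply, smul_eq_mul, eval_sub, eval_mul, eval_pow, eval_X,
            zero_pow hc.ne', zero_mul, sub_zero]
          split_ifs <;> simp
        · intro r _ hr
          simp [K', hq, hr]
        · simp
    have h1 : N.det.coeff 0 = ((Polynomial.evalRingHom (0 : S)).mapMatrix N).det := by
      rw [← RingHom.map_det, coeff_zero_eq_eval_zero]; rfl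
    rw [h1, hN, Matrix.det_mul, det_chainCycle_zero hd, one_mul, det_of_topBlock hd K']
    · congr 1
      ext i j
      simp only [K', Matrix.of_apply, if_pos (isChainTop_chainTop hd j)]
      rw [dif_neg]
      · rfl
      · have := (isChainTop_chainTop hd i).ge
        exact not_lt.2 this
    · intro p q hq
      simp [K', hq]

end ChainMatrices

/-! ### Weighted substitution in bivariate polynomials -/

section Bivariate

variable {S : Type*} [CommRing S]

/-- The substitution `t ↦ X ^ c u` from `S[t][X]` to `S[u][X]`. -/
noncomputable def weightSubst (S : Type*) [CommRing S] (c : ℕ) : S[X][X] →+* S[X][X] :=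
  eval₂RingHom (eval₂RingHom ((C : S[X] →+* S[X][X]).comp C) (X ^ c * C X)) X

/-- The monomial `X^q t^r` goes to `X^(q + c r) u^r`, so distinct monomials stay distinct and no
coefficients are merged. -/
theorem coeff_coeff_weightSubst (c : ℕ) (P : S[X][X]) (m p : ℕ) :
    ((weightSubst S c P).coeff m).coeff p =
      if c * p ≤ m then (P.coeff (m - c * p)).coeff p else 0 := by
  induction P using Polynomial.induction_on' with
  | add P Q hP hQ =>
    rw [map_add, coeff_add, coeff_add, hP, hQ, coeff_add, coeff_add]
    split_ifs <;> simp
  | monomial q a =>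
    induction a using Polynomial.induction_on' with
    | add a b ha hb =>
      rw [map_add, map_add, coeff_add, coeff_add, ha, hb, coeff_add, coeff_add]
      split_ifs <;> simp
    | monomial r a =>
      have h : weightSubst S c (monomial q (monomial r a)) =
          monomial (q + c * r) (monomial r a) := by
        simp only [weightSubst, coe_eval₂RingHom, eval₂_monomial, RingHom.comp_apply]
        rw [← C_mul_X_pow_eq_monomial (n := q + c * r), ← C_mul_X_pow_eq_monomial (n := r)]
        simp only [map_mul, map_pow]
        ring
      rw [h, coeff_monomial, coeff_monomial]
      by_cases h1 : r = p
      · subst h1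
        by_cases h2 : q + c * r = m
        · rw [if_pos h2, if_pos (by omega), if_pos (by omega)]
        · rw [if_neg h2]
          split_ifs <;> first | rfl | (exfalso; omega)
      · split_ifs <;> simp [coeff_monomial, h1]

end Bivariate

/-! ### Newton polygon of the characteristic polynomial of `E + t Y` -/

section ChainCharpoly

variable {J : Type*} [Fintype J] [DecidableEq J] {d : J → ℕ} {F : Type*} [CommRing F] [IsDomain F]

variable (d) in
/-- The characteristic polynomial of `E + t Y` over the ring of polynomials in `t`. -/
noncomputable def chainCharpoly (Y : Matrix (Σ j, Fin (d j)) (Σ j, Fin (d j)) F) : F[X][X] :=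
  ((chainShift d F).map C + (X : F[X]) • Y.map C).charpoly

omit [IsDomain F] in
theorem weightSubst_chainCharpoly (c : ℕ) (Y : Matrix (Σ j, Fin (d j)) (Σ j, Fin (d j)) F) :
    weightSubst F c (chainCharpoly d Y) =
      ((X : F[X][X]) • (1 : Matrix (Σ j, Fin (d j)) (Σ j, Fin (d j)) F[X][X]) -
        chainShift d F[X][X] - (X ^ c * C X : F[X][X]) • (Y.map C).map C).det := by
  rw [chainCharpoly, Matrix.charpoly, RingHom.map_det]
  congr 1
  ext1 p q
  simp only [RingHom.mapMatrix_apply, Matrix.map_apply, Matrix.charmatrix, Matrix.sub_apply,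
    Matrix.scalar_apply, Matrix.diagonal_apply, Matrix.smul_apply, Matrix.one_apply, chainShift,
    Matrix.of_apply, weightSubst, coe_eval₂RingHom, smul_eq_mul, Matrix.add_apply]
  have h1 : eval₂ (eval₂RingHom ((C : F[X] →+* F[X][X]).comp C) (X ^ c * C X)) X
      (if p = q then (X : F[X][X]) else 0) = X * if p = q then 1 else 0 := by
    split_ifs <;> simp
  have h2 : eval₂ ((C : F[X] →+* F[X][X]).comp C) (X ^ c * C X)
      (C (if p.1 = q.1 ∧ (p.2 : ℕ) = q.2 + 1 then (1 : F) else 0)) =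
      if p.1 = q.1 ∧ (p.2 : ℕ) = q.2 + 1 then 1 else 0 := by
    split_ifs <;> simp
  rw [Polynomial.eval₂_sub, h1, eval₂_C, coe_eval₂RingHom, eval₂_add, h2, eval₂_mul, eval₂_X,
    eval₂_C, sub_sub]
  rfl

/-- The monomials `X^q t^p` of weight `q + c p = ∑ min(d_j, c)` lie on the supporting line of the
Newton polygon, where the coefficients are those of the small determinant. Those of smaller weight
vanish, by the next lemma. -/
theorem coeff_coeff_chainCharpoly (hd : ∀ j, 0 < d j) {c : ℕ} (hc : 0 < c)
    (Y : Matrix (Σ j, Fin (d j)) (Σ j, Fin (d j)) F) {q p : ℕ}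
    (h : q + c * p = ∑ j, min (d j) c) :
    ((chainCharpoly d Y).coeff q).coeff p =
      (chainCorner hd c (X : F[X]) (Y.map C)).det.coeff p := by
  obtain ⟨H, h1, h2⟩ := exists_det_eq_pow_mul hd hc (X : F[X]) (Y.map C)
  have h3 := coeff_coeff_weightSubst c (chainCharpoly d Y) (q + c * p) p
  rw [if_pos (by omega), Nat.add_sub_cancel, weightSubst_chainCharpoly, h1, h] at h3
  rw [← h3, ← h2]
  have := coeff_X_pow_mul H (∑ j, min (d j) c) 0
  rw [zero_add] at this
  rw [this]

theorem coeff_coeff_chainCharpoly_eq_zero (hd : ∀ j, 0 < d j) {c : ℕ} (hc : 0 < c)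
    (Y : Matrix (Σ j, Fin (d j)) (Σ j, Fin (d j)) F) {q p : ℕ}
    (h : q + c * p < ∑ j, min (d j) c) :
    ((chainCharpoly d Y).coeff q).coeff p = 0 := by
  obtain ⟨H, h1, h2⟩ := exists_det_eq_pow_mul hd hc (X : F[X]) (Y.map C)
  have h3 := coeff_coeff_weightSubst c (chainCharpoly d Y) (q + c * p) p
  rw [if_pos (by omega), Nat.add_sub_cancel, weightSubst_chainCharpoly, h1] at h3
  rw [← h3, coeff_X_pow_mul', if_neg (by omega), coeff_zero]

omit [IsDomain F] in
theorem eval_coeff_chainCharpoly (Y : Matrix (Σ j, Fin (d j)) (Σ j, Fin (d j)) F) (q : ℕ) (t : F) :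
    ((chainCharpoly d Y).coeff q).eval t = (chainShift d F + t • Y).charpoly.coeff q := by
  have h : chainShift d F + t • Y =
      ((chainShift d F).map C + (X : F[X]) • Y.map C).map (evalRingHom t) := by
    ext1 p q
    simp only [Matrix.add_apply, Matrix.smul_apply, Matrix.map_apply, smul_eq_mul, coe_evalRingHom,
      eval_add, eval_mul, eval_C, eval_X]
  rw [h, Matrix.charpoly_map, coeff_map]
  rfl

end ChainCharpoly

/-! ### Very good sequences and multiplicities -/

section Sequences

theorem nEven_succ (lam : ℕ → ℕ) (k : ℕ) :
    nEven lam (k + 1) = nEven lam k + if Even (lam (k + 1)) then 1 else 0 := by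
  rw [nEven, nEven, ← Finset.insert_Icc_right_eq_Icc_add_one (by omega), Finset.filter_insert]
  split_ifs
  · rw [Finset.card_insert_of_notMem (by simp)]
  · rfl

theorem nEven_zero (lam : ℕ → ℕ) : nEven lam 0 = 0 := by simp [nEven]

theorem nEven_eq_add {lam : ℕ → ℕ} {i : ℕ} (n : ℕ)
    (h : ∀ j, i < j → j ≤ i + n → Even (lam j)) : nEven lam (i + n) = nEven lam i + n := by
  induction n with
  | zero => rfl
  | succ n ih =>
    rw [← add_assoc, nEven_succ, ih fun j h1 h2 => h j h1 (by omega),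
      if_pos (h _ (by omega) (by omega)), add_assoc]

theorem nEven_mono (lam : ℕ → ℕ) {i j : ℕ} (h : i ≤ j) : nEven lam i ≤ nEven lam j :=
  Finset.card_le_card (Finset.filter_subset_filter _ (Finset.Icc_subset_Icc_right h))

/-- If no even value occurs on both sides of the cut at `i`, each even value met before the cut has
its full, even, multiplicity there. -/
theorem even_nEven_of_separated {lam : ℕ → ℕ} {k i : ℕ}
    (hmult : ∀ a, Even a → Even ((Finset.Icc 1 k).filter (fun i => lam i = a)).card) (hik : i ≤ k)
    (hsep : ∀ j j', 1 ≤ j → j ≤ i → i < j' → j' ≤ k → Even (lam j) → lam j ≠ lam j') :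
    Even (nEven lam i) := by
  rw [nEven, Finset.card_eq_sum_card_image lam]
  refine Finset.even_sum _ fun a ha => ?_
  obtain ⟨j, hj, rfl⟩ := Finset.mem_image.1 ha
  rw [Finset.mem_filter, Finset.mem_Icc] at hj
  refine (congrArg (fun s : Finset ℕ => Even s.card) ?_).mpr (hmult _ hj.2)
  ext j'
  simp only [Finset.mem_filter, Finset.mem_Icc]
  constructor
  · rintro ⟨⟨h1, _⟩, h3⟩
    exact ⟨⟨h1.1, h1.2.trans hik⟩, h3⟩
  · rintro ⟨h1, h2⟩
    refine ⟨⟨⟨h1.1, ?_⟩, h2 ▸ hj.2⟩, h2⟩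
    by_contra h3
    exact hsep j j' hj.1.1 hj.1.2 (by omega) h1.2 hj.2 h2.symm

/-- The parity pattern of an orthogonal partition: the even entries come in pairs between
consecutive odd entries. -/
structure EvenBlocks (lam : ℕ → ℕ) (k : ℕ) : Prop where
  total : Even (nEven lam k)
  odd : ∀ i, 1 ≤ i → i ≤ k → Odd (lam i) → Even (nEven lam i)

theorem IsOrthPartition.evenBlocks {lam : ℕ → ℕ} {k : ℕ} (h : IsOrthPartition lam k) :
    EvenBlocks lam k where
  total := even_nEven_of_separated h.even_mult le_rfl fun j j' _ _ h1 h2 => by omega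
  odd := fun i hi1 hik hi => by
    refine even_nEven_of_separated h.even_mult hik fun j j' h1 h2 h3 h4 h5 h6 => ?_
    have h7 := h.anti j i h1 h2 hik
    have h8 := h.anti i j' hi1 h3.le h4
    have h9 : lam i = lam j := by omega
    rw [h9] at hi
    exact Nat.not_even_iff_odd.2 hi h5

/-- Two leading even entries survive every reduction in the recursion for `d_λ`, and each reduction
keeps the parity of the length and the pattern of even blocks. So the obstruction to being very good
propagates from the shortest sequences. -/
theorem EvenBlocks.dNum_bound {lam : ℕ → ℕ} (h1 : Even (lam 1)) (h2 : Even (lam 2)) (k : ℕ) :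
    EvenBlocks lam k → 2 ≤ k →
      (Even k → 0 < dNum lam k) ∧ (Odd k → dNum lam k < nEven lam k) := by
  have hn2 : nEven lam 2 = 2 := by
    rw [nEven_succ, nEven_succ, nEven_zero, if_pos h1, if_pos h2]
  induction k using Nat.strong_induction_on with
  | _ k ih =>
  intro hb hk
  have hge := nEven_mono lam hk
  rw [dNum]
  split_ifs with c2 c c' c4
  · subst c2
    rw [hn2]
    exact ⟨fun _ => two_pos, fun h => absurd h (by decide)⟩
  · obtain ⟨_, ho1, ho2⟩ := c
    obtain ⟨n, rfl⟩ : ∃ n, k = n + 2 := ⟨k - 2, by omega⟩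
    rw [show n + 2 - 1 = n + 1 from rfl] at ho2
    have hn : nEven lam (n + 2) = nEven lam n := by
      rw [nEven_succ, nEven_succ, if_neg (Nat.not_even_iff_odd.2 ho1),
        if_neg (Nat.not_even_iff_odd.2 ho2)]
      rfl
    have hn2' : 2 ≤ n := by
      by_contra hlt
      obtain rfl | rfl : n = 0 ∨ n = 1 := by omega
      · exact c2 rfl
      · exact Nat.not_even_iff_odd.2 ho2 h2
    have := ih n (by omega) ⟨hn ▸ hb.total, fun i a b => hb.odd i a (by omega)⟩ hn2'
    rw [Nat.add_sub_cancel, hn, Nat.even_add, Nat.odd_add]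
    simpa using this
  · obtain ⟨_, ho1, ho2⟩ := c'
    obtain ⟨n, rfl⟩ : ∃ n, k = n + 2 := ⟨k - 2, by omega⟩
    rw [show n + 2 - 1 = n + 1 from rfl] at ho2
    have hn : nEven lam (n + 2) = nEven lam n + 2 := by
      rw [nEven_succ, nEven_succ, if_pos ho1, if_pos ho2]
    refine ⟨fun _ => by omega, fun ho => ?_⟩
    have hn2' : 2 ≤ n := by
      by_contra hlt
      obtain rfl | rfl : n = 0 ∨ n = 1 := by omega
      · exact c2 rfl
      · have := hb.total
        rw [hn, nEven_succ, nEven_zero, if_pos h1] at this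
        exact absurd this (by decide)
    have := (ih n (by omega) ⟨by simpa [hn, Nat.even_add] using hb.total,
      fun i a b => hb.odd i a (by omega)⟩ hn2').2 (by simpa [Nat.odd_add] using ho)
    rw [Nat.add_sub_cancel, hn]
    omega
  · obtain ⟨_, ho, hc2, hck, hoc, hev⟩ := Classical.choose_spec c4
    set c' := Classical.choose c4 with hc'
    obtain ⟨n, hcn⟩ : ∃ n, c' = n + 1 := ⟨c' - 1, by omega⟩
    rw [hcn] at hoc hev hck hc2 ⊢
    have hn : nEven lam (n + 1) = nEven lam n := by
      rw [nEven_succ, if_neg (Nat.not_even_iff_odd.2 hoc)]; rfl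
    have hn2' : 2 ≤ n := by
      by_contra hlt
      obtain rfl : n = 1 := by omega
      exact Nat.not_even_iff_odd.2 hoc h2
    have hne := hb.odd (n + 1) (by omega) (by omega) hoc
    rw [hn] at hne
    have := ih n (by omega) ⟨hne, fun i a b => hb.odd i a (by omega)⟩ hn2'
    have hk1 : nEven lam k = nEven lam (k - 1) := by
      obtain ⟨r, rfl⟩ : ∃ r, k = r + 1 := ⟨k - 1, by omega⟩
      rw [nEven_succ, if_neg (Nat.not_even_iff_odd.2 ho)]; rfl
    have hk2 := nEven_eq_add (lam := lam) (i := n + 1) (k - 1 - (n + 1))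
      fun j a b => hev j a (by omega)
    rw [show n + 1 + (k - 1 - (n + 1)) = k - 1 by omega, ← hk1, hn] at hk2
    have hpar := hb.total
    rw [hk2, Nat.even_add] at hpar
    have hpar2 := hpar.1 hne
    -- The removed segment consists of two odd entries and an even number of even ones between them.
    have hkn : Even k ↔ Even n := by
      have : k = (k - 1 - (n + 1)) + (n + 2) := by omega
      rw [this, Nat.even_add, Nat.even_add]
      simp [hpar2]
    rw [Nat.add_sub_cancel, ← Nat.not_even_iff_odd, hkn, Nat.not_even_iff_odd]
    exact ⟨this.1, fun h => (this.2 h).trans_le (by omega)⟩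
  -- No reduction applies. For even length the last entry would be odd and the one before it even;
  -- the last odd entry before these would lie beyond position `2` and allow the fourth rule.
  · refine ⟨fun hek => ?_, fun _ => by omega⟩
    exfalso
    obtain ⟨n, rfl⟩ : ∃ n, k = n + 1 := ⟨k - 1, by omega⟩
    have ho : Odd (lam (n + 1)) := by
      by_contra he
      rw [Nat.not_odd_iff_even] at he
      have hn : ¬ Even (lam n) := fun h => c' ⟨hk, he, h⟩
      have h3 := hb.odd n (by omega) (by omega) (Nat.not_even_iff_odd.1 hn)
      have h4 := hb.total
      rw [nEven_succ, if_pos he, Nat.even_add] at h4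
      exact absurd (h4.1 h3) (by decide)
    have hn : Even (lam n) := by
      by_contra h
      exact c ⟨hk, ho, Nat.not_even_iff_odd.1 h⟩
    have hN : nEven lam (n + 1) = nEven lam n := by
      rw [nEven_succ, if_neg (Nat.not_even_iff_odd.2 ho)]; rfl
    have hno : ¬ Even n := by
      rw [Nat.even_add_one] at hek; exact hek
    -- the last odd entry before the position `n + 1`
    have hex : ∃ i, 1 ≤ i ∧ i ≤ n ∧ Odd (lam i) := by
      by_contra! hall
      have h5 := nEven_eq_add (lam := lam) (i := 0) n
        fun j a b => Nat.not_odd_iff_even.1 (hall j a (by omega))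
      have h6 := hb.total
      rw [nEven_zero, zero_add] at h5
      rw [hN, h5] at h6
      exact hno h6
    have hne : ((Finset.Icc 1 n).filter fun i => Odd (lam i)).Nonempty := by
      obtain ⟨i, a, b, c⟩ := hex
      exact ⟨i, by simp [a, b, c]⟩
    have hmem := Finset.max'_mem _ hne
    set i := Finset.max' _ hne with hi
    rw [Finset.mem_filter, Finset.mem_Icc] at hmem
    have hi3 : 2 < i := by
      by_contra hlt
      have := hmem.1.1
      obtain h0 | h0 : i = 1 ∨ i = 2 := by omega
      · rw [h0] at hmem; exact Nat.not_even_iff_odd.2 hmem.2 h1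
      · rw [h0] at hmem; exact Nat.not_even_iff_odd.2 hmem.2 h2
    have hin : i ≠ n := by
      intro h0; rw [h0] at hmem; exact Nat.not_even_iff_odd.2 hmem.2 hn
    refine c4 ⟨i, by omega, ho, by omega, by omega, hmem.2, fun j a b => ?_⟩
    by_contra hj
    have := Finset.le_max' ((Finset.Icc 1 n).filter fun i => Odd (lam i)) j
      (by simp only [Finset.mem_filter, Finset.mem_Icc]
          exact ⟨by omega, Nat.not_even_iff_odd.1 hj⟩)
    omega

/-- If the first entry were even, so would be the second, since even entries come in pairs; then
`EvenBlocks.dNum_bound` contradicts the definition of very good. -/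
theorem IsVeryGood.odd_one {lam : ℕ → ℕ} {k : ℕ} (h : IsVeryGood lam k) (hk : 0 < k) :
    Odd (lam 1) := by
  by_contra h1
  rw [Nat.not_odd_iff_even] at h1
  have hb := h.orth.evenBlocks
  have hn1 : nEven lam 1 = 1 := by rw [nEven_succ, nEven_zero, if_pos h1]
  have hk2 : 2 ≤ k := by
    by_contra hlt
    obtain rfl : k = 1 := by omega
    have := hb.total
    rw [hn1] at this
    exact absurd this (by decide)
  have h2 : Even (lam 2) := by
    by_contra h2
    have := hb.odd 2 (by omega) hk2 (Nat.not_even_iff_odd.1 h2)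
    rw [nEven_succ, hn1, if_neg h2] at this
    exact absurd this (by decide)
  have := EvenBlocks.dNum_bound h1 h2 k hb hk2
  rcases Nat.even_or_odd k with he | ho
  · exact (this.1 he).ne' (h.even_case he)
  · exact (this.2 ho).ne (h.odd_case ho).symm

/-- A sequence that satisfies the condition `(∗)`, with the properties of `λ_1, …, λ_{k'}` that
follow from it. -/
structure PairedHead (lam : ℕ → ℕ) (k k' : ℕ) : Prop where
  two_le : 2 ≤ k'
  le : k' ≤ k
  pos : ∀ i, 1 ≤ i → i ≤ k → 0 < lam i
  anti : ∀ i j, 1 ≤ i → i ≤ j → j ≤ k → lam j ≤ lam i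
  even : ∀ i, 1 ≤ i → i ≤ k' → Even (lam i)
  tail_lt : ∀ i j, 1 ≤ i → i ≤ k' → k' < j → j ≤ k → lam j < lam i
  even_length : Even k'
  pair : ∀ l, 1 ≤ l → 2 * l ≤ k' → lam (2 * l - 1) = lam (2 * l)

/-- The tail starts with an odd entry, so it lies strictly below the even head. A cut inside the
head between two different values therefore comes after an even number of entries, so it never
separates `2l - 1` from `2l`. -/
theorem StarCondition.pairedHead {lam : ℕ → ℕ} {k k' : ℕ} (h : StarCondition lam k k')
    (pos : ∀ i, 1 ≤ i → i ≤ k → 0 < lam i)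
    (anti : ∀ i j, 1 ≤ i → i ≤ j → j ≤ k → lam j ≤ lam i)
    (hmult : ∀ a, Even a → Even ((Finset.Icc 1 k).filter (fun i => lam i = a)).card) :
    PairedHead lam k k' := by
  have h2 := h.two_le
  have hle := h.le
  have htail : ∀ i j, 1 ≤ i → i ≤ k' → k' < j → j ≤ k → lam j < lam i := by
    intro i j hi1 hik hj1 hj2
    have ho := h.veryGood.odd_one (by omega)
    have he := h.even k' (by omega) le_rfl
    have h3 := anti i k' hi1 hik hle
    have h4 := anti k' (k' + 1) (by omega) (by omega) (by omega)
    have h5 := anti (k' + 1) j (by omega) (by omega) (by omega)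
    have h6 : lam (k' + 1) ≠ lam k' := by
      intro h6
      rw [h6] at ho
      exact Nat.not_even_iff_odd.2 ho he
    omega
  have hall : ∀ i, i ≤ k' → nEven lam i = i := by
    intro i hi
    have := nEven_eq_add (lam := lam) (i := 0) i fun j a b => h.even j a (by omega)
    rwa [nEven_zero, zero_add] at this
  have hsep : ∀ i, i ≤ k' →
      (∀ j j', 1 ≤ j → j ≤ i → i < j' → j' ≤ k → Even (lam j) → lam j ≠ lam j') → Even i := by
    intro i hi hs
    rw [← hall i hi]
    exact even_nEven_of_separated hmult (by omega) hs
  refine ⟨h2, hle, pos, anti, h.even, htail, ?_, ?_⟩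
  · exact hsep k' le_rfl fun j j' h1 h2 h3 h4 _ => (htail j j' h1 h2 h3 h4).ne'
  · intro l hl1 hl2
    by_contra hne
    have h7 := anti (2 * l - 1) (2 * l) (by omega) (by omega) (by omega)
    have : Even (2 * l - 1) := hsep _ (by omega) fun j j' a b c d _ => by
      have h8 := anti j (2 * l - 1) a b (by omega)
      have h9 := anti (2 * l) j' (by omega) (by omega) d
      omega
    obtain ⟨r, hr⟩ := this
    omega

theorem le_card_filter_iff {n : ℕ} {P : ℕ → Prop} [DecidablePred P]
    (hP : ∀ i j, 1 ≤ i → i ≤ j → j ≤ n → P j → P i) {i : ℕ} (hi : 1 ≤ i) (hin : i ≤ n) :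
    i ≤ ((Finset.Icc 1 n).filter P).card ↔ P i := by
  constructor
  · intro h
    by_contra hPi
    have hsub : (Finset.Icc 1 n).filter P ⊆ Finset.Icc 1 (i - 1) := by
      intro j hj
      rw [Finset.mem_filter, Finset.mem_Icc] at hj
      rw [Finset.mem_Icc]
      refine ⟨hj.1.1, ?_⟩
      by_contra hlt
      exact hPi (hP i j hi (by omega) hj.1.2 hj.2)
    have := Finset.card_le_card hsub
    rw [Nat.card_Icc] at this
    omega
  · intro h
    have hsub : Finset.Icc 1 i ⊆ (Finset.Icc 1 n).filter P := by
      intro j hj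
      rw [Finset.mem_Icc] at hj
      rw [Finset.mem_filter, Finset.mem_Icc]
      exact ⟨⟨hj.1, by omega⟩, hP j i hj.1 hj.2 hin h⟩
    have := Finset.card_le_card hsub
    rw [Nat.card_Icc] at this
    omega

theorem muVal_strictAnti (lam : ℕ → ℕ) (k' : ℕ) {s t : ℕ} (hs : 1 ≤ s) (hst : s < t)
    (ht : t ≤ numValues lam k') : muVal lam k' t < muVal lam k' s := by
  have hlen : (((Finset.Icc 1 k').image lam).sort (fun a b => b ≤ a)).length = numValues lam k' :=
    Finset.length_sort _
  have hsort := ((Finset.Icc 1 k').image lam).pairwise_sort (fun a b => b ≤ a)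
  have hnd := ((Finset.Icc 1 k').image lam).sort_nodup (fun a b => b ≤ a)
  rw [muVal, muVal, List.getD_eq_getElem _ _ (by omega), List.getD_eq_getElem _ _ (by omega)]
  refine lt_of_le_of_ne (List.pairwise_iff_getElem.1 hsort _ _ _ _ (by omega)) ?_
  intro heq
  have := (List.Nodup.getElem_inj_iff hnd).1 heq
  omega

theorem exists_eq_muVal (lam : ℕ → ℕ) {k' i : ℕ} (h1 : 1 ≤ i) (h2 : i ≤ k') :
    ∃ s, 1 ≤ s ∧ s ≤ numValues lam k' ∧ lam i = muVal lam k' s := by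
  have hlen : (((Finset.Icc 1 k').image lam).sort (fun a b => b ≤ a)).length = numValues lam k' :=
    Finset.length_sort _
  have hmem : lam i ∈ ((Finset.Icc 1 k').image lam).sort (fun a b => b ≤ a) := by
    rw [Finset.mem_sort]
    exact Finset.mem_image_of_mem _ (Finset.mem_Icc.2 ⟨h1, h2⟩)
  obtain ⟨n, hn, he⟩ := List.getElem_of_mem hmem
  refine ⟨n + 1, by omega, by omega, ?_⟩
  rw [muVal, Nat.add_sub_cancel, List.getD_eq_getElem _ _ hn, he]

theorem multSum_eq_card (lam : ℕ → ℕ) (k' : ℕ) {s : ℕ} (hs : 1 ≤ s) (hsm : s ≤ numValues lam k') :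
    multSum lam k' s = ((Finset.Icc 1 k').filter fun i => muVal lam k' s ≤ lam i).card := by
  induction s, hs using Nat.le_induction with
  | base =>
    rw [multSum, Finset.sum_range_succ, Finset.sum_range_one, multVal, if_pos rfl, zero_add,
      multVal, if_neg one_ne_zero]
    congr 1
    refine Finset.filter_congr fun i hi => ?_
    rw [Finset.mem_Icc] at hi
    obtain ⟨t, ht1, ht2, ht⟩ := exists_eq_muVal lam hi.1 hi.2
    refine ⟨fun h => h.ge, fun h => ?_⟩
    rcases ht1.eq_or_lt with rfl | hlt
    · exact ht
    · have := muVal_strictAnti lam k' le_rfl hlt ht2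
      omega
  | succ s hs ih =>
    have ih := ih (by omega)
    rw [multSum] at ih
    rw [multSum, Finset.sum_range_succ, ih, multVal, if_neg (by omega),
      ← Finset.card_union_of_disjoint]
    · congr 1
      ext i
      simp only [Finset.mem_union, Finset.mem_filter, Finset.mem_Icc, ← and_or_left]
      refine and_congr_right fun hi => ?_
      have hlt := muVal_strictAnti lam k' hs (lt_add_one s) hsm
      obtain ⟨t, ht1, ht2, ht⟩ := exists_eq_muVal lam hi.1 hi.2
      refine ⟨fun h => by omega, fun h => ?_⟩
      rcases lt_trichotomy t (s + 1) with h3 | h3 | h3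
      · left
        rcases (Nat.lt_succ_iff.1 h3).eq_or_lt with rfl | h4
        · exact ht.ge
        · rw [ht]; exact (muVal_strictAnti lam k' ht1 h4 (by omega)).le
      · right; rw [ht, h3]
      · have := muVal_strictAnti lam k' (by omega) h3 ht2
        omega
    · rw [Finset.disjoint_left]
      intro i hi hi'
      rw [Finset.mem_filter] at hi hi'
      have hlt := muVal_strictAnti lam k' hs (lt_add_one s) hsm
      omega

theorem multSum_zero (lam : ℕ → ℕ) (k' : ℕ) : multSum lam k' 0 = 0 := by
  simp [multSum, multVal]

theorem multSum_succ (lam : ℕ → ℕ) (k' s : ℕ) :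
    multSum lam k' (s + 1) = multSum lam k' s + multVal lam k' (s + 1) := by
  rw [multSum, Finset.sum_range_succ]; rfl

theorem multSum_le (lam : ℕ → ℕ) (k' : ℕ) {s : ℕ} (hsm : s ≤ numValues lam k') :
    multSum lam k' s ≤ k' := by
  rcases Nat.eq_zero_or_pos s with rfl | hs
  · rw [multSum_zero]; omega
  · rw [multSum_eq_card lam k' hs hsm]
    refine (Finset.card_filter_le _ _).trans ?_
    rw [Nat.card_Icc]; omega

namespace PairedHead

variable {lam : ℕ → ℕ} {k k' : ℕ} (h : PairedHead lam k k')
include h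

theorem le_multSum_iff {s i : ℕ} (hs : 1 ≤ s) (hsm : s ≤ numValues lam k') (hi : 1 ≤ i)
    (hik : i ≤ k') : i ≤ multSum lam k' s ↔ muVal lam k' s ≤ lam i := by
  rw [multSum_eq_card lam k' hs hsm]
  exact le_card_filter_iff (P := fun i => muVal lam k' s ≤ lam i)
    (fun i j h1 h2 h3 h4 => h4.trans (h.anti i j h1 h2 (h3.trans h.le))) hi hik

theorem le_multSum_pred_iff {s i : ℕ} (hs : 1 ≤ s) (hsm : s ≤ numValues lam k') (hi : 1 ≤ i)
    (hik : i ≤ k') : i ≤ multSum lam k' (s - 1) ↔ muVal lam k' s < lam i := by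
  obtain ⟨t, ht1, ht2, ht⟩ := exists_eq_muVal lam hi hik
  rcases hs.eq_or_lt with rfl | hs'
  · rw [Nat.sub_self, multSum_zero, ht]
    rcases ht1.eq_or_lt with rfl | hlt
    · simp; omega
    · have := muVal_strictAnti lam k' le_rfl hlt ht2
      omega
  · rw [h.le_multSum_iff (by omega) (by omega) hi hik, ht]
    have hlt := muVal_strictAnti lam k' (s := s - 1) (t := s) (by omega) (by omega) hsm
    refine ⟨fun h => hlt.trans_le h, fun h => ?_⟩
    rcases lt_trichotomy t (s - 1) with h3 | h3 | h3
    · exact (muVal_strictAnti lam k' ht1 h3 (by omega)).le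
    · rw [h3]
    · rcases (show s ≤ t by omega).eq_or_lt with rfl | h4
      · omega
      · have := muVal_strictAnti lam k' hs h4 ht2
        omega

/-- If the number of entries `≥ μ_s` were odd, the last of them would have a partner of equal value
that is not counted. -/
theorem even_multSum {s : ℕ} (hsm : s ≤ numValues lam k') : Even (multSum lam k' s) := by
  rcases Nat.eq_zero_or_pos s with rfl | hs
  · rw [multSum_zero]; exact Even.zero
  · by_contra hodd
    rw [Nat.not_even_iff_odd] at hodd
    obtain ⟨r, hr⟩ := hodd
    have hle := multSum_le lam k' hsm
    obtain ⟨n, hn⟩ := h.even_length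
    have h1 := (h.le_multSum_iff hs hsm (i := 2 * r + 1) (by omega) (by omega)).1 hr.ge
    have h2 := h.pair (r + 1) (by omega) (by omega)
    rw [show 2 * (r + 1) - 1 = 2 * r + 1 by omega] at h2
    rw [h2] at h1
    have h3 := (h.le_multSum_iff hs hsm (i := 2 * (r + 1)) (by omega) (by omega)).2 h1
    omega

end PairedHead

end Sequences

/-! ### Simple modules over an `𝔰𝔩₂`-triple and adapted bases -/

section SimpleModules

variable {𝕜 : Type*} [Field 𝕜] {V : Type*} [AddCommGroup V] [Module 𝕜 V]
  {B : LinearMap.BilinForm 𝕜 V}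

/-- `W` has a basis `v, e v, …, e ^ (d - 1) v` of a chain of length `d`, and `f ^ (d - 1)` maps the
last vector to a nonzero multiple of the first one. -/
structure IsSl2Chain (e f : Module.End 𝕜 V) (W : Submodule 𝕜 V) (d : ℕ) (v : V) : Prop where
  pos : 0 < d
  e_pow : (e ^ d) v = 0
  linearIndependent : LinearIndependent 𝕜 fun a : Fin d => (e ^ (a : ℕ)) v
  span_eq : Submodule.span 𝕜 (Set.range fun a : Fin d => (e ^ (a : ℕ)) v) = W
  f_pow : ∃ c : 𝕜, c ≠ 0 ∧ (f ^ (d - 1)) ((e ^ (d - 1)) v) = c • v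

/-- A submodule that contains a vector of a simple submodule contains the simple submodule. -/
theorem le_of_isIrreducible {e h f : skewAdjointLieSubalgebra B}
    (U : LieSubmodule 𝕜 (tripleSpan e h f) V) [LieModule.IsIrreducible 𝕜 (tripleSpan e h f) U]
    (W : Submodule 𝕜 V) {v : V} (hv0 : v ≠ 0) (hvU : v ∈ U) (hvW : v ∈ W)
    (he : ∀ w ∈ W, (e : Module.End 𝕜 V) w ∈ W) (hh : ∀ w ∈ W, (h : Module.End 𝕜 V) w ∈ W)
    (hf : ∀ w ∈ W, (f : Module.End 𝕜 V) w ∈ W) : (U : Submodule 𝕜 V) ≤ W := by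
  let S : LieSubalgebra 𝕜 (skewAdjointLieSubalgebra B) :=
    { carrier := {x | ∀ w ∈ W, (x : Module.End 𝕜 V) w ∈ W}
      add_mem' := fun ha hb w hw => W.add_mem (ha w hw) (hb w hw)
      zero_mem' := fun _ _ => W.zero_mem
      smul_mem' := fun c _ ha w hw => W.smul_mem c (ha w hw)
      lie_mem' := fun {x y} ha hb w hw => W.sub_mem (ha _ (hb w hw)) (hb _ (ha w hw)) }
  have hS : tripleSpan e h f ≤ S := by
    rw [LieSubalgebra.lieSpan_le]
    rintro x (rfl | rfl | rfl)
    · exact he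
    · exact hh
    · exact hf
  let N : LieSubmodule 𝕜 (tripleSpan e h f) U :=
    { (W.comap (U : Submodule 𝕜 V).subtype) with
      lie_mem := fun {x m} hm => hS x.2 _ hm }
  have hN : N = ⊤ := by
    refine (IsSimpleOrder.eq_bot_or_eq_top N).resolve_left fun hbot => ?_
    have : (⟨v, hvU⟩ : U) ∈ N := hvW
    rw [hbot, LieSubmodule.mem_bot] at this
    exact hv0 (congrArg Subtype.val this)
  intro w hw
  have : (⟨w, hw⟩ : U) ∈ N := by rw [hN]; trivial
  exact this

variable [IsAlgClosed 𝕜] [CharZero 𝕜] [FiniteDimensional 𝕜 V]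

theorem exists_isSl2Chain {e h f : skewAdjointLieSubalgebra B} (ht : IsSl2Triple h e f)
    (U : LieSubmodule 𝕜 (tripleSpan e h f) V)
    [hirr : LieModule.IsIrreducible 𝕜 (tripleSpan e h f) U] :
    ∃ v : V, IsSl2Chain (e : Module.End 𝕜 V) (f : Module.End 𝕜 V) (U : Submodule 𝕜 V)
      (Module.finrank 𝕜 U) v := by
  have hsub := LieSubalgebra.subset_lieSpan (R := 𝕜) (L := skewAdjointLieSubalgebra B)
    (s := {e, h, f})
  let e' : tripleSpan e h f := ⟨e, hsub (by simp)⟩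
  let h' : tripleSpan e h f := ⟨h, hsub (by simp)⟩
  let f' : tripleSpan e h f := ⟨f, hsub (by simp)⟩
  have ht' : IsSl2Triple h' e' f' :=
    ⟨fun h0 => ht.h_ne_zero (congrArg Subtype.val h0), Subtype.ext ht.lie_e_f,
      Subtype.ext ht.lie_h_e_nsmul, Subtype.ext ht.lie_h_f_nsmul⟩
  have hnt : Nontrivial U := by
    have := hirr.toNontrivial
    exact (LieSubmodule.nontrivial_iff 𝕜 (tripleSpan e h f) U).1 this
  -- The symmetric triple exchanges `e` and `f` and negates `h`, so its primitive vector is a lowest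
  -- weight vector: `f` kills it and the powers of `e` generate the module.
  obtain ⟨μ, m, hm0, hP'⟩ := ht'.symm.exists_hasPrimitiveVectorWith (R := 𝕜) (M := U)
  have hP : ht.symm.HasPrimitiveVectorWith (m : V) μ :=
    ⟨fun h0 => hm0 (Subtype.ext h0), congrArg Subtype.val hP'.lie_h,
      congrArg Subtype.val hP'.lie_e⟩
  obtain ⟨n, hn⟩ := hP.exists_nat
  have hne : ∀ i ≤ n, ((e : Module.End 𝕜 V) ^ i) (m : V) ≠ 0 := fun i hi =>
    hP.pow_toEnd_f_ne_zero_of_eq_nat hn hi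
  have hzero : ((e : Module.End 𝕜 V) ^ (n + 1)) (m : V) = 0 :=
    hP.pow_toEnd_f_eq_zero_of_eq_nat hn
  have hh : ∀ i : ℕ, (h : Module.End 𝕜 V) (((e : Module.End 𝕜 V) ^ i) (m : V)) =
      (2 * i - μ) • ((e : Module.End 𝕜 V) ^ i) (m : V) := by
    intro i
    have h1 : -((h : Module.End 𝕜 V) (((e : Module.End 𝕜 V) ^ i) (m : V))) =
      (μ - 2 * i) • ((e : Module.End 𝕜 V) ^ i) (m : V) := hP.lie_h_pow_toEnd_f i
    rw [← neg_inj, h1, ← neg_smul, neg_sub]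
  have hf : ∀ i : ℕ, (f : Module.End 𝕜 V) (((e : Module.End 𝕜 V) ^ (i + 1)) (m : V)) =
      ((i + 1) * (μ - i)) • ((e : Module.End 𝕜 V) ^ i) (m : V) :=
    fun i => hP.lie_e_pow_succ_toEnd_f i
  have hf0 : (f : Module.End 𝕜 V) (m : V) = 0 := hP.lie_e
  have hmemU : ∀ i : ℕ, ((e : Module.End 𝕜 V) ^ i) (m : V) ∈ U := by
    intro i
    induction i with
    | zero => exact m.2
    | succ i ih =>
      rw [pow_succ']
      exact U.lie_mem (x := e') ih
  have hli : LinearIndependent 𝕜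
      fun a : Fin (n + 1) => ((e : Module.End 𝕜 V) ^ (a : ℕ)) (m : V) := by
    refine Module.End.eigenvectors_linearIndependent' (h : Module.End 𝕜 V)
      (fun a : Fin (n + 1) => 2 * ((a : ℕ) : 𝕜) - μ) ?_ _ fun a => ?_
    · intro a b hab
      have h1 : (2 : 𝕜) * ((a : ℕ) : 𝕜) = 2 * ((b : ℕ) : 𝕜) := sub_left_injective hab
      exact Fin.ext (Nat.cast_injective (mul_left_cancel₀ two_ne_zero h1))
    · exact ⟨Module.End.mem_eigenspace_iff.2 (hh a), hne a (Nat.lt_succ_iff.1 a.2)⟩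
  set W := Submodule.span 𝕜
    (Set.range fun a : Fin (n + 1) => ((e : Module.End 𝕜 V) ^ (a : ℕ)) (m : V)) with hW
  have hmemW : ∀ i : ℕ, ((e : Module.End 𝕜 V) ^ i) (m : V) ∈ W := by
    intro i
    by_cases hi : i < n + 1
    · exact Submodule.subset_span ⟨⟨i, hi⟩, rfl⟩
    · obtain ⟨r, rfl⟩ : ∃ r, i = r + (n + 1) := ⟨i - (n + 1), by omega⟩
      rw [pow_add, Module.End.mul_apply, hzero, map_zero]
      exact W.zero_mem
  have hstab : ∀ x : Module.End 𝕜 V, (∀ i : ℕ, x (((e : Module.End 𝕜 V) ^ i) (m : V)) ∈ W) →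
      ∀ w ∈ W, x w ∈ W := by
    intro x hx w hw
    induction hw using Submodule.span_induction with
    | mem w hw => obtain ⟨a, rfl⟩ := hw; exact hx a
    | zero => rw [map_zero]; exact W.zero_mem
    | add a b _ _ ha hb => rw [map_add]; exact W.add_mem ha hb
    | smul c a _ ha => rw [map_smul]; exact W.smul_mem c ha
  have hWU : W = U := by
    refine le_antisymm (Submodule.span_le.2 ?_) ?_
    · rintro _ ⟨a, rfl⟩
      exact hmemU a
    · refine le_of_isIrreducible U W (v := m) (fun h0 => hm0 (Subtype.ext h0)) m.2 (hmemW 0)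
        (hstab _ fun i => ?_) (hstab _ fun i => ?_) (hstab _ fun i => ?_)
      · rw [← Module.End.mul_apply, ← pow_succ']
        exact hmemW _
      · rw [hh]
        exact W.smul_mem _ (hmemW _)
      · cases i with
        | zero => rw [pow_zero, Module.End.one_apply, hf0]; exact W.zero_mem
        | succ i => rw [hf]; exact W.smul_mem _ (hmemW _)
  have hrank : Module.finrank 𝕜 U = n + 1 := by
    have h1 : Module.finrank 𝕜 U = Module.finrank 𝕜 W := by rw [hWU]; rfl
    rw [h1, hW, finrank_span_eq_card hli, Fintype.card_fin]
  rw [hrank]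
  refine ⟨m, Nat.succ_pos _, hzero, hli, hWU, ?_⟩
  -- The scalar is the product of the factors `(a + 1) (n - a)` for `a < i`, all nonzero in
  -- characteristic zero.
  have hprod : ∀ i ≤ n, ∃ c : 𝕜, c ≠ 0 ∧ ((f : Module.End 𝕜 V) ^ i)
      (((e : Module.End 𝕜 V) ^ i) (m : V)) = c • (m : V) := by
    intro i
    induction i with
    | zero => exact fun _ => ⟨1, one_ne_zero, by simp⟩
    | succ i ih =>
      intro hi
      obtain ⟨c, hc, hci⟩ := ih (by omega)
      refine ⟨(i + 1) * (μ - i) * c, mul_ne_zero (mul_ne_zero ?_ ?_) hc, ?_⟩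
      · exact_mod_cast Nat.succ_ne_zero i
      · rw [hn, sub_ne_zero]
        exact_mod_cast (show n ≠ i by omega)
      · rw [pow_succ, Module.End.mul_apply, hf, map_smul, hci, smul_smul]
  exact hprod n le_rfl

end SimpleModules

section AdaptedBasis

variable {𝕜 : Type*} [Field 𝕜] {V : Type*} [AddCommGroup V] [Module 𝕜 V]

/-- `b` is a basis of `V` that consists of chains `v_j, e v_j, …`, `1 ≤ j ≤ k`, that span the
subspaces `U j`. -/
structure IsChainBasis (e f : Module.End 𝕜 V) (lam : ℕ → ℕ) (k : ℕ) (U : ℕ → Submodule 𝕜 V)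
    (v : ℕ → V) (b : Module.Basis (Σ j : Finset.Icc 1 k, Fin (lam j)) 𝕜 V) : Prop where
  pos : ∀ j : Finset.Icc 1 k, 0 < lam j
  apply : ∀ p, b p = (e ^ (p.2 : ℕ)) (v p.1)
  e_pow : ∀ j : Finset.Icc 1 k, (e ^ lam j) (v j) = 0
  f_pow : ∀ j : Finset.Icc 1 k, ∃ c : 𝕜, c ≠ 0 ∧
    (f ^ (lam j - 1)) ((e ^ (lam j - 1)) (v j)) = c • v j
  mem_iff : ∀ (j : Finset.Icc 1 k) (x : V), x ∈ U j ↔ ∀ p, p.1 ≠ j → b.repr x p = 0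
  f_mem : ∀ (j : Finset.Icc 1 k), ∀ x ∈ U j, f x ∈ U j

theorem IsAdaptedDecomposition.exists_isChainBasis [IsAlgClosed 𝕜] [CharZero 𝕜]
    [FiniteDimensional 𝕜 V] {B : LinearMap.BilinForm 𝕜 V} {e h f : skewAdjointLieSubalgebra B}
    (ht : IsSl2Triple h e f) {lam : ℕ → ℕ} {k k' : ℕ}
    {U : ℕ → LieSubmodule 𝕜 (tripleSpan e h f) V}
    (hU : IsAdaptedDecomposition e h f lam k k' U) :
    ∃ (v : ℕ → V) (b : Module.Basis (Σ j : Finset.Icc 1 k, Fin (lam j)) 𝕜 V),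
      IsChainBasis (e : Module.End 𝕜 V) (f : Module.End 𝕜 V) lam k (asSubspaces U) v b := by
  have hch : ∀ j : ℕ, ∃ v : V, j ∈ Finset.Icc 1 k →
      IsSl2Chain (e : Module.End 𝕜 V) (f : Module.End 𝕜 V) (U j : Submodule 𝕜 V) (lam j) v := by
    intro j
    by_cases hj : j ∈ Finset.Icc 1 k
    · have := hU.irreducible j hj
      obtain ⟨v, hv⟩ := exists_isSl2Chain ht (U j)
      rw [hU.finrank_eq j hj] at hv
      exact ⟨v, fun _ => hv⟩
    · exact ⟨0, fun h => absurd h hj⟩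
  choose v hv using hch
  have hint : DirectSum.IsInternal fun j : Finset.Icc 1 k => (U j : Submodule 𝕜 V) := by
    rw [DirectSum.isInternal_submodule_iff_iSupIndep_and_iSup_eq_top]
    refine ⟨hU.indep, ?_⟩
    rw [← hU.span, iSup_subtype]
  let bj : ∀ j : Finset.Icc 1 k, Module.Basis (Fin (lam j)) 𝕜 (U j : Submodule 𝕜 V) := fun j =>
    (Module.Basis.span (hv j j.2).linearIndependent).map (LinearEquiv.ofEq _ _ (hv j j.2).span_eq)
  have hbj : ∀ (j : Finset.Icc 1 k) (a : Fin (lam j)),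
      (bj j a : V) = ((e : Module.End 𝕜 V) ^ (a : ℕ)) (v j) := by
    intro j a
    simp only [bj, Module.Basis.map_apply, LinearEquiv.coe_ofEq_apply]
    exact congrArg _ (Module.Basis.span_apply _ _)
  have happly : ∀ p, hint.collectedBasis bj p = ((e : Module.End 𝕜 V) ^ (p.2 : ℕ)) (v p.1) := by
    intro p
    rw [DirectSum.IsInternal.collectedBasis_coe]
    exact hbj p.1 p.2
  have hmemb : ∀ p, hint.collectedBasis bj p ∈ (U p.1 : Submodule 𝕜 V) := fun p =>
    hint.collectedBasis_mem bj p
  refine ⟨v, hint.collectedBasis bj, ?_⟩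
  refine ⟨fun j => (hv j j.2).pos, happly, fun j => (hv j j.2).e_pow, fun j => (hv j j.2).f_pow,
    ?_, ?_⟩
  · intro j x
    constructor
    · rintro hx ⟨i, a⟩ hij
      exact hint.collectedBasis_repr_of_mem_ne bj (Ne.symm hij) hx
    · intro hx
      rw [← (hint.collectedBasis bj).sum_repr x]
      refine Submodule.sum_mem _ fun p _ => ?_
      by_cases hp : p.1 = j
      · exact Submodule.smul_mem _ _ (hp ▸ hmemb p)
      · rw [hx p hp, zero_smul]
        exact Submodule.zero_mem _
  · intro j x hx
    have hsub := LieSubalgebra.subset_lieSpan (R := 𝕜) (L := skewAdjointLieSubalgebra B)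
      (s := {e, h, f})
    exact (U j).lie_mem (x := ⟨f, hsub (by simp)⟩) hx

end AdaptedBasis

/-! ### Homogeneous components along lines -/

section HomComponents

variable {𝕜 : Type*} [Field 𝕜] {W : Type*} [AddCommGroup W] [Module 𝕜 W]

theorem homComponent_eq [Infinite 𝕜] {F : W → 𝕜} {x : W} {P : 𝕜[X]}
    (hP : ∀ t : 𝕜, P.eval t = F (t • x)) (n : ℕ) : homComponent F n x = P.coeff n := by
  have hex : ∃ P : 𝕜[X], ∀ t : 𝕜, P.eval t = F (t • x) := ⟨P, hP⟩
  rw [homComponent, dif_pos hex]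
  congr 1
  exact Polynomial.funext fun t => by rw [Classical.choose_spec hex t, hP t]

theorem initialComponent_eq {F : W → 𝕜} {i : ℕ} (h0 : ∀ n < i, homComponent F n = 0)
    (hi : homComponent F i ≠ 0) : initialComponent F = homComponent F i := by
  rw [initialComponent]
  congr 1
  refine le_antisymm (Nat.sInf_le hi) ?_
  by_contra hlt
  exact Nat.sInf_mem (s := {n | homComponent F n ≠ 0}) ⟨i, hi⟩ (h0 _ (not_le.1 hlt))

/-- On each line through the origin, `G` is the square of a polynomial divisible by `X^m`, where `m`
is the initial degree of `F`. So the component of `G` of degree `2m` is the square of the initial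
component of `F`; it is nonzero and nothing precedes it, which forces `i = 2m`. -/
theorem initialComponent_sq [Infinite 𝕜] {F G : W → 𝕜} (hFG : ∀ x, F x ^ 2 = G x)
    (hF : ∀ x, ∃ P : 𝕜[X], ∀ t : 𝕜, P.eval t = F (t • x)) {i : ℕ}
    (h0 : ∀ n < i, homComponent G n = 0) (hi : homComponent G i ≠ 0) :
    initialComponent F ^ 2 = homComponent G i := by
  choose P hP using hF
  have hQ : ∀ x t, (P x ^ 2).eval t = G (t • x) := fun x t => by
    rw [eval_pow, hP, hFG]
  have hne : {n | homComponent F n ≠ 0}.Nonempty := by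
    by_contra hemp
    rw [Set.not_nonempty_iff_eq_empty] at hemp
    refine hi (funext fun x => ?_)
    have hP0 : P x = 0 := by
      ext n
      rw [← homComponent_eq (hP x) n]
      by_contra hn
      have : n ∈ {n | homComponent F n ≠ 0} := fun h => hn (by rw [h]; rfl)
      rw [hemp] at this
      exact this
    rw [homComponent_eq (hQ x), hP0]
    simp
  set m := sInf {n | homComponent F n ≠ 0} with hm
  have hlow : ∀ x, ∀ n < m, (P x).coeff n = 0 := by
    intro x n hn
    have := Nat.notMem_of_lt_sInf hn
    rw [Set.mem_ofPred_eq, not_not] at this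
    rw [← homComponent_eq (hP x) n, this]
    rfl
  have hdvd : ∀ x, ∃ R : 𝕜[X], P x = X ^ m * R := fun x =>
    X_pow_dvd_iff.2 (hlow x)
  have hG : ∀ n x, homComponent G n x = (P x ^ 2).coeff n := fun n x => homComponent_eq (hQ x) n
  have h2m : ∀ x, homComponent G (m + m) x = (P x).coeff m ^ 2 := by
    intro x
    obtain ⟨R, hR⟩ := hdvd x
    have e1 := coeff_X_pow_mul R m 0
    have e2 := coeff_X_pow_mul (R ^ 2) (m + m) 0
    rw [zero_add] at e1 e2
    rw [hG, hR, e1, mul_pow, ← pow_mul, mul_two, e2, sq, mul_coeff_zero, ← sq]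
  have hlow2 : ∀ n < m + m, homComponent G n = 0 := by
    intro n hn
    funext x
    obtain ⟨R, hR⟩ := hdvd x
    rw [hG, hR, mul_pow, ← pow_mul, mul_two, coeff_X_pow_mul', if_neg (by omega)]
    rfl
  have hmm : homComponent G (m + m) ≠ 0 := by
    intro hz
    have hmem : homComponent F m ≠ 0 := Nat.sInf_mem hne
    refine hmem (funext fun x => ?_)
    rw [homComponent_eq (hP x) m]
    have := h2m x
    rw [hz] at this
    exact pow_eq_zero_iff two_ne_zero |>.1 this.symm
  have hi2 : i = m + m := by
    rcases lt_trichotomy i (m + m) with h | h | h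
    · exact absurd (hlow2 i h) hi
    · exact h
    · exact absurd (h0 _ h) hmm
  funext x
  rw [hi2, h2m, Pi.pow_apply, initialComponent, ← hm, homComponent_eq (hP x)]

theorem IsPolynomialFunction.exists_polynomial {F : W → 𝕜} (hF : IsPolynomialFunction F)
    (x y : W) : ∃ P : 𝕜[X], ∀ t : 𝕜, P.eval t = F (x + t • y) := by
  induction hF using Algebra.adjoin_induction with
  | mem F hF =>
    obtain ⟨φ, rfl⟩ := hF
    exact ⟨C (φ x) + X * C (φ y), fun t => by
      rw [eval_add, eval_mul, eval_C, eval_C, eval_X]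
      exact ((φ.map_add x (t • y)).trans (congrArg _ (φ.map_smul t y))).symm⟩
  | algebraMap r => exact ⟨C r, fun t => by simp⟩
  | add F G _ _ hF hG =>
    obtain ⟨P, hP⟩ := hF
    obtain ⟨Q, hQ⟩ := hG
    exact ⟨P + Q, fun t => by rw [eval_add, hP, hQ]; rfl⟩
  | mul F G _ _ hF hG =>
    obtain ⟨P, hP⟩ := hF
    obtain ⟨Q, hQ⟩ := hG
    exact ⟨P * Q, fun t => by rw [eval_mul, hP, hQ]; rfl⟩

end HomComponents

/-! ### The polynomials `p_i` as coefficients of a small determinant -/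

section LeadingTerms

variable {𝕜 : Type*} [Field 𝕜] {V : Type*} [AddCommGroup V] [Module 𝕜 V]

theorem finrank_eq_sum_of_chain {lam : ℕ → ℕ} {k : ℕ}
    (b : Module.Basis (Σ j : Finset.Icc 1 k, Fin (lam j)) 𝕜 V) :
    Module.finrank 𝕜 V = ∑ j ∈ Finset.Icc 1 k, lam j := by
  rw [Module.finrank_eq_card_basis b, Fintype.card_sigma]
  simp only [Fintype.card_fin]
  exact Finset.sum_coe_sort (Finset.Icc 1 k) lam

namespace IsChainBasis

variable {e f : Module.End 𝕜 V} {lam : ℕ → ℕ} {k : ℕ} {U : ℕ → Submodule 𝕜 V} {v : ℕ → V}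
  {b : Module.Basis (Σ j : Finset.Icc 1 k, Fin (lam j)) 𝕜 V} (hb : IsChainBasis e f lam k U v b)
include hb

theorem toMatrix_e : LinearMap.toMatrix b b e = chainShift (fun j : Finset.Icc 1 k => lam j) 𝕜 := by
  ext p q
  rw [LinearMap.toMatrix_apply, hb.apply, ← Module.End.mul_apply, ← pow_succ']
  simp only [chainShift, Matrix.of_apply]
  by_cases hq : (q.2 : ℕ) + 1 < lam q.1
  · have h1 := hb.apply ⟨q.1, ⟨q.2 + 1, hq⟩⟩
    simp only at h1
    rw [← h1, Module.Basis.repr_self, Finsupp.single_apply]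
    congr 1
    refine propext ⟨?_, ?_⟩
    · rintro rfl
      exact ⟨rfl, rfl⟩
    · rintro ⟨h2, h3⟩
      exact (chain_ext (q := ⟨q.1, ⟨q.2 + 1, hq⟩⟩) h2 h3).symm
  · have h1 := q.2.2
    rw [show (q.2 : ℕ) + 1 = lam q.1 by omega, hb.e_pow, map_zero, if_neg]
    · rfl
    · rintro ⟨h2, h3⟩
      have h4 := p.2.2
      have h5 : lam p.1 = lam q.1 := by rw [h2]
      omega

theorem eval_coeff_chainCharpoly [FiniteDimensional 𝕜 V] (y : Module.End 𝕜 V) (q : ℕ) (t : 𝕜) :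
    ((chainCharpoly (fun j : Finset.Icc 1 k => lam j) (LinearMap.toMatrix b b y)).coeff q).eval t =
      (LinearMap.charpoly (e + t • y)).coeff q := by
  rw [_root_.eval_coeff_chainCharpoly, ← hb.toMatrix_e, ← map_smul, ← map_add,
    LinearMap.charpoly_toMatrix]

/-- The coefficient of `u ^ i` in the small determinant for the truncation level `c = λ_i`. -/
noncomputable def cornerCoeff (y : Module.End 𝕜 V) (i : ℕ) : 𝕜 :=
  (chainCorner (d := fun j : Finset.Icc 1 k => lam j) hb.pos (lam i) (X : 𝕜[X])
    ((LinearMap.toMatrix b b y).map C)).det.coeff i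

end IsChainBasis

/-- Truncating at `λ_i` replaces each of the first `i` entries by `λ_i` and leaves the others
unchanged. This puts the monomial of `Q_{2ν_i}` of degree `i` on the supporting line of slope `λ_i`.
-/
theorem PairedHead.sum_min {lam : ℕ → ℕ} {k k' : ℕ} (h : PairedHead lam k k') {i : ℕ}
    (hi1 : 1 ≤ i) (hik : i ≤ k') :
    (∑ j ∈ Finset.Icc 1 k, lam j) + lam i * i =
      ∑ j ∈ Finset.Icc 1 k, min (lam j) (lam i) + ∑ j ∈ Finset.Icc 1 i, lam j := by
  have hle := h.le
  have hsplit : ∀ g : ℕ → ℕ, ∑ j ∈ Finset.Icc 1 k, g j =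
      ∑ j ∈ Finset.Icc 1 i, g j + ∑ j ∈ Finset.Icc (i + 1) k, g j := by
    intro g
    rw [← Finset.sum_union]
    · congr 1
      ext j
      simp only [Finset.mem_union, Finset.mem_Icc]
      omega
    · rw [Finset.disjoint_left]
      intro j h1 h2
      rw [Finset.mem_Icc] at h1 h2
      omega
  rw [hsplit, hsplit fun j => min (lam j) (lam i)]
  have h1 : ∑ j ∈ Finset.Icc 1 i, min (lam j) (lam i) = lam i * i := by
    rw [Finset.sum_congr rfl (g := fun _ => lam i), Finset.sum_const, Nat.card_Icc, smul_eq_mul,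
      mul_comm]
    · rfl
    · intro j hj
      rw [Finset.mem_Icc] at hj
      exact min_eq_right (h.anti j i hj.1 hj.2 (by omega))
  have h2 : ∑ j ∈ Finset.Icc (i + 1) k, min (lam j) (lam i) =
      ∑ j ∈ Finset.Icc (i + 1) k, lam j := by
    refine Finset.sum_congr rfl fun j hj => ?_
    rw [Finset.mem_Icc] at hj
    exact min_eq_left (h.anti i j hi1 (by omega) hj.2)
  rw [h1, h2]
  ring

theorem PairedHead.two_mul_nuVal {lam : ℕ → ℕ} {k k' : ℕ} (h : PairedHead lam k k') {i : ℕ}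
    (hik : i ≤ k') : 2 * nuVal lam i = ∑ j ∈ Finset.Icc 1 i, lam j := by
  refine Nat.mul_div_cancel' (Finset.dvd_sum fun j hj => ?_)
  rw [Finset.mem_Icc] at hj
  exact (h.even j hj.1 (by omega)).two_dvd

variable [IsAlgClosed 𝕜] [FiniteDimensional 𝕜 V] {B : LinearMap.BilinForm 𝕜 V}
  {e f : skewAdjointLieSubalgebra B} {lam : ℕ → ℕ} {k k' : ℕ} {U : ℕ → Submodule 𝕜 V}
  {v : ℕ → V} {b : Module.Basis (Σ j : Finset.Icc 1 k, Fin (lam j)) 𝕜 V}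

theorem IsChainBasis.homComponent_charCoeff
    (hb : IsChainBasis (e : Module.End 𝕜 V) (f : Module.End 𝕜 V) lam k U v b)
    (h : PairedHead lam k k') {i : ℕ} (hi1 : 1 ≤ i) (hik : i ≤ k') :
    (∀ n < i, homComponent (fun x : centralizerOf f => charCoeff (2 * nuVal lam i)
      (e + (x : skewAdjointLieSubalgebra B))) n = 0) ∧
    ∀ x, homComponent (fun x : centralizerOf f => charCoeff (2 * nuVal lam i)
      (e + (x : skewAdjointLieSubalgebra B))) i x =
      hb.cornerCoeff ((x : skewAdjointLieSubalgebra B) : Module.End 𝕜 V) i := by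
  have hle := h.le
  have hc : 0 < lam i := h.pos i hi1 (by omega)
  have hcoef : ∀ (n : ℕ) (x : centralizerOf f),
      homComponent (fun x : centralizerOf f => charCoeff (2 * nuVal lam i)
      (e + (x : skewAdjointLieSubalgebra B))) n x =
        ((chainCharpoly (fun j : Finset.Icc 1 k => lam j) (LinearMap.toMatrix b b
          ((x : skewAdjointLieSubalgebra B) : Module.End 𝕜 V))).coeff
            (Module.finrank 𝕜 V - 2 * nuVal lam i)).coeff n := by
    intro n x
    refine homComponent_eq (fun t => ?_) n
    rw [hb.eval_coeff_chainCharpoly]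
    rfl
  have hsum := h.sum_min hi1 hik
  have hmin : ∑ j : Finset.Icc 1 k, min (lam j) (lam i) =
      ∑ j ∈ Finset.Icc 1 k, min (lam j) (lam i) :=
    Finset.sum_coe_sort (Finset.Icc 1 k) fun j => min (lam j) (lam i)
  have hsub : ∑ j ∈ Finset.Icc 1 i, lam j ≤ ∑ j ∈ Finset.Icc 1 k, lam j :=
    Finset.sum_le_sum_of_subset (Finset.Icc_subset_Icc_right (by omega))
  have hq : Module.finrank 𝕜 V - 2 * nuVal lam i + lam i * i =
      ∑ j : Finset.Icc 1 k, min (lam j) (lam i) := by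
    rw [finrank_eq_sum_of_chain b, h.two_mul_nuVal hik, hmin]
    omega
  constructor
  · intro n hn
    funext x
    rw [hcoef]
    refine coeff_coeff_chainCharpoly_eq_zero (d := fun j : Finset.Icc 1 k => lam j) hb.pos hc _ ?_
    rw [← hq]
    have := Nat.mul_lt_mul_of_pos_left hn hc
    omega
  · intro x
    rw [hcoef]
    exact coeff_coeff_chainCharpoly (d := fun j : Finset.Icc 1 k => lam j) hb.pos hc _ hq

/-- The nonvanishing assumption makes degree `i` the initial degree of `Q_{2ν_i}` on the slice. The
exceptional invariant occurs only for `i = k = k'`, where the square in the definition of `p_k`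
returns to `Q_{2ℓ}`. -/
theorem IsChainBasis.pPoly_eq
    (hb : IsChainBasis (e : Module.End 𝕜 V) (f : Module.End 𝕜 V) lam k U v b)
    (h : PairedHead lam k k') {ℓ : ℕ}
    (hℓ : Module.finrank 𝕜 V = 2 * ℓ + 1 ∨ Module.finrank 𝕜 V = 2 * ℓ)
    {pf : skewAdjointLieSubalgebra B → 𝕜}
    (hpf : Module.finrank 𝕜 V = 2 * ℓ →
      IsPolynomialFunction pf ∧ ∀ x, pf x ^ 2 = charCoeff (2 * ℓ) x)
    {i : ℕ} (hi1 : 1 ≤ i) (hik : i ≤ k')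
    (hne : ∃ x : centralizerOf f,
      hb.cornerCoeff ((x : skewAdjointLieSubalgebra B) : Module.End 𝕜 V) i ≠ 0)
    (x : centralizerOf f) :
    pPoly e f ℓ pf lam k k' i x =
      hb.cornerCoeff ((x : skewAdjointLieSubalgebra B) : Module.End 𝕜 V) i := by
  have hle := h.le
  obtain ⟨h1, h2⟩ := hb.homComponent_charCoeff h hi1 hik
  have h3 : homComponent (fun x : centralizerOf f => charCoeff (2 * nuVal lam i)
      (e + (x : skewAdjointLieSubalgebra B))) i ≠ 0 := by
    obtain ⟨y, hy⟩ := hne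
    intro h0
    rw [← h2, h0] at hy
    exact hy rfl
  have hlam : Module.finrank 𝕜 V = ∑ j ∈ Finset.Icc 1 k, lam j :=
    finrank_eq_sum_of_chain b
  have hnu := h.two_mul_nuVal hik
  rw [pPoly, if_neg (by omega)]
  by_cases hlast : k' = k ∧ i = k
  · obtain ⟨rfl, rfl⟩ := hlast
    have hl : nuVal lam i = ℓ := by omega
    have hl2 : Module.finrank 𝕜 V = 2 * ℓ := by omega
    obtain ⟨hpf1, hpf2⟩ := hpf hl2
    have hpol : ∀ y : centralizerOf f, ∃ P : 𝕜[X], ∀ t : 𝕜,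
        P.eval t = pf (e + ((t • y : centralizerOf f) : skewAdjointLieSubalgebra B)) :=
      fun y => hpf1.exists_polynomial e (y : skewAdjointLieSubalgebra B)
    have hsq : ∀ y : centralizerOf f, pf (e + (y : skewAdjointLieSubalgebra B)) ^ 2 =
        charCoeff (2 * nuVal lam i) (e + (y : skewAdjointLieSubalgebra B)) := fun y => by
      rw [hl, hpf2]
    have hfin := initialComponent_sq hsq hpol h1 h3
    rw [if_pos ⟨rfl, rfl⟩, qInv, if_pos ⟨hl2, hl⟩, ← h2, ← hfin]
    rfl
  -- For `i < k` the positive entry `λ_k` is missing from the sum, so `2 ν_i < dim V`.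
  · have hcond : ¬ (Module.finrank 𝕜 V = 2 * ℓ ∧ nuVal lam i = ℓ) := by
      rintro ⟨h4, h5⟩
      have h6 : i ≠ k := fun h6 => hlast ⟨by omega, h6⟩
      have h7 : ∑ j ∈ Finset.Icc 1 i, lam j < ∑ j ∈ Finset.Icc 1 k, lam j := by
        refine Finset.sum_lt_sum_of_subset (i := k) (Finset.Icc_subset_Icc_right (by omega)) ?_ ?_
          (h.pos k (by omega) le_rfl) fun _ _ _ => Nat.zero_le _
        · rw [Finset.mem_Icc]; omega
        · rw [Finset.mem_Icc]; omega
      omega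
    rw [if_neg hlast, qInv, if_neg hcond, initialOnSlice, initialComponent_eq h1 h3, h2]

end LeadingTerms

/-! ### Even parts have even multiplicity -/

section SkewForms

variable {𝕜 : Type*} [Field 𝕜] {V : Type*} [AddCommGroup V] [Module 𝕜 V]
  {B : LinearMap.BilinForm 𝕜 V}

theorem skewAdjoint_apply (x : skewAdjointLieSubalgebra B) (v w : V) :
    B ((x : Module.End 𝕜 V) v) w = -B v ((x : Module.End 𝕜 V) w) := by
  have h := (LinearMap.mem_skewAdjointSubmodule (B := B) (x : Module.End 𝕜 V)).1 x.2 v w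
  rw [h, Pi.neg_apply, map_neg]

theorem skewAdjoint_pow_apply (x : skewAdjointLieSubalgebra B) (n : ℕ) (v w : V) :
    B (((x : Module.End 𝕜 V) ^ n) v) w = (-1) ^ n * B v (((x : Module.End 𝕜 V) ^ n) w) := by
  induction n generalizing w with
  | zero => simp
  | succ n ih =>
    rw [pow_succ', Module.End.mul_apply, skewAdjoint_apply, ih, ← Module.End.mul_apply, ← pow_succ,
      ← pow_succ', pow_succ (-1 : 𝕜)]
    ring

theorem skewAdjoint_odd_pow_apply_self [CharZero 𝕜] (hB : B.IsSymm)
    (x : skewAdjointLieSubalgebra B) {n : ℕ} (hn : Odd n) (v : V) :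
    B v (((x : Module.End 𝕜 V) ^ n) v) = 0 := by
  have h := skewAdjoint_pow_apply x n v v
  rw [hn.neg_one_pow, neg_one_mul, hB.eq] at h
  exact self_eq_neg.1 h

theorem even_card_of_skew_of_det_ne_zero [CharZero 𝕜] {ι : Type*} [Fintype ι] [DecidableEq ι]
    {G : Matrix ι ι 𝕜} (hG : G.transpose = -G) (hdet : G.det ≠ 0) : Even (Fintype.card ι) := by
  by_contra hodd
  rw [Nat.not_even_iff_odd] at hodd
  have h := congrArg Matrix.det hG
  rw [Matrix.det_transpose, Matrix.det_neg, hodd.neg_one_pow, neg_one_mul] at h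
  exact hdet (self_eq_neg.1 h)

variable {e : skewAdjointLieSubalgebra B} {f : Module.End 𝕜 V} {lam : ℕ → ℕ} {k : ℕ}
  {U : ℕ → Submodule 𝕜 V} {v : ℕ → V}
  {b : Module.Basis (Σ j : Finset.Icc 1 k, Fin (lam j)) 𝕜 V}

theorem IsChainBasis.pow_apply_eq_zero (hb : IsChainBasis (e : Module.End 𝕜 V) f lam k U v b)
    {j : ℕ} (hj : j ∈ Finset.Icc 1 k) {n : ℕ} (hn : lam j ≤ n) :
    ((e : Module.End 𝕜 V) ^ n) (v j) = 0 := by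
  obtain ⟨r, rfl⟩ : ∃ r, n = r + lam j := ⟨n - lam j, by omega⟩
  rw [pow_add, Module.End.mul_apply, hb.e_pow ⟨j, hj⟩, map_zero]

theorem IsChainBasis.eq_zero_of_forall (hBl : ∀ x, (∀ y, B x y = 0) → x = 0) (hB : B.IsSymm)
    (b : Module.Basis (Σ j : Finset.Icc 1 k, Fin (lam j)) 𝕜 V) {x : V}
    (hx : ∀ p, B (b p) x = 0) : x = 0 := by
  refine hBl x fun y => ?_
  rw [hB.eq, ← b.sum_repr y, LinearMap.BilinForm.sum_left]
  exact Finset.sum_eq_zero fun p _ => by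
    rw [LinearMap.BilinForm.smul_left, hx, mul_zero]

/-- The sum is the rank of `e^m`. For odd `m` the form `(x, y) ↦ B x (e^m y)` is alternating and
descends to a nondegenerate form on `V / ker e^m`, which then has even dimension; `G` is its Gram
matrix. -/
theorem IsChainBasis.even_sum_sub [CharZero 𝕜] (hBl : ∀ x, (∀ y, B x y = 0) → x = 0)
    (hB : B.IsSymm) (hb : IsChainBasis (e : Module.End 𝕜 V) f lam k U v b) {m : ℕ} (hm : Odd m) :
    Even (∑ j ∈ Finset.Icc 1 k, (lam j - m)) := by
  have hcard : ∑ j ∈ Finset.Icc 1 k, (lam j - m) =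
      Fintype.card (Σ j : Finset.Icc 1 k, Fin (lam j - m)) := by
    rw [Fintype.card_sigma]
    simp only [Fintype.card_fin]
    exact (Finset.sum_coe_sort (Finset.Icc 1 k) fun j => lam j - m).symm
  rw [hcard]
  let w : (Σ j : Finset.Icc 1 k, Fin (lam j - m)) → V := fun p =>
    ((e : Module.End 𝕜 V) ^ (p.2 : ℕ)) (v p.1)
  let G : Matrix (Σ j : Finset.Icc 1 k, Fin (lam j - m))
      (Σ j : Finset.Icc 1 k, Fin (lam j - m)) 𝕜 :=
    Matrix.of fun p q => B (w p) (((e : Module.End 𝕜 V) ^ m) (w q))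
  refine even_card_of_skew_of_det_ne_zero (G := G) ?_ ?_
  · ext p q
    simp only [G, Matrix.transpose_apply, Matrix.of_apply, Matrix.neg_apply]
    rw [hB.eq, skewAdjoint_pow_apply, hm.neg_one_pow, neg_one_mul]
  · intro hdet
    obtain ⟨c, hc0, hc⟩ := Matrix.exists_mulVec_eq_zero_iff.2 hdet
    refine hc0 ?_
    let sh : (Σ j : Finset.Icc 1 k, Fin (lam j - m)) → Σ j : Finset.Icc 1 k, Fin (lam j) :=
      fun p => ⟨p.1, ⟨p.2 + m, by have := p.2.2; omega⟩⟩
    have hsh : Function.Injective sh := by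
      intro p q hpq
      have h1 : p.1 = q.1 := congrArg (fun r : Σ j : Finset.Icc 1 k, Fin (lam j) => r.1) hpq
      have h2 : (p.2 : ℕ) + m = q.2 + m :=
        congrArg (fun r : Σ j : Finset.Icc 1 k, Fin (lam j) => (r.2 : ℕ)) hpq
      exact chain_ext h1 (by omega)
    have hbw : ∀ p, b (sh p) = ((e : Module.End 𝕜 V) ^ m) (w p) := by
      intro p
      rw [hb.apply, ← Module.End.mul_apply, ← pow_add, add_comm]
    -- The vector is orthogonal to every basis vector: for positions below `λ_j - m` by `G c = 0`,
    -- and for the others because `e^m`, moved across the form, kills them.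
    have hsum : ∑ q, c q • b (sh q) = 0 := by
      refine IsChainBasis.eq_zero_of_forall hBl hB b fun p => ?_
      rw [LinearMap.BilinForm.sum_right]
      by_cases hp : (p.2 : ℕ) < lam p.1 - m
      · have h1 := congrFun hc ⟨p.1, ⟨p.2, hp⟩⟩
        rw [Matrix.mulVec, dotProduct] at h1
        rw [← Pi.zero_apply (M := fun _ => 𝕜)
          (⟨p.1, ⟨p.2, hp⟩⟩ : Σ j : Finset.Icc 1 k, Fin (lam j - m)), ← h1]
        refine Finset.sum_congr rfl fun q _ => ?_
        rw [LinearMap.BilinForm.smul_right, hbw, hb.apply, mul_comm]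
        rfl
      · refine Finset.sum_eq_zero fun q _ => ?_
        rw [LinearMap.BilinForm.smul_right, hbw, hB.eq, skewAdjoint_pow_apply, hb.apply,
          ← Module.End.mul_apply, ← pow_add, hb.pow_apply_eq_zero p.1.2 (by omega), map_zero,
          mul_zero, mul_zero]
    exact funext fun q => (Fintype.linearIndependent_iff.1 (b.linearIndependent.comp sh hsh) c
      hsum) q

theorem IsChainBasis.even_multiplicity [CharZero 𝕜] (hBl : ∀ x, (∀ y, B x y = 0) → x = 0)
    (hB : B.IsSymm) (hb : IsChainBasis (e : Module.End 𝕜 V) f lam k U v b) {a : ℕ} (ha : Even a) :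
    Even ((Finset.Icc 1 k).filter (fun i => lam i = a)).card := by
  rcases Nat.eq_zero_or_pos a with rfl | hpos
  · rw [Finset.filter_eq_empty_iff.2]
    · exact Even.zero
    · intro j hj
      exact (hb.pos ⟨j, hj⟩).ne'
  · obtain ⟨m, rfl⟩ : ∃ m, a = m + 1 := ⟨a - 1, by omega⟩
    have hm : Odd m := by
      rw [← Nat.not_even_iff_odd, ← Nat.even_add_one]; exact ha
    have h1 := hb.even_sum_sub hBl hB hm
    have h2 := hb.even_sum_sub hBl hB (m := m + 2) (hm.add_even even_two)
    -- The ranks of `e^m` and `e^(m+2)` are both even, and their difference is the multiplicity of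
    -- `m + 1` modulo `2`.
    have h3 : ∑ j ∈ Finset.Icc 1 k, (lam j - m) = ∑ j ∈ Finset.Icc 1 k, (lam j - (m + 2)) +
        2 * ((Finset.Icc 1 k).filter fun j => m + 2 ≤ lam j).card +
        ((Finset.Icc 1 k).filter fun j => lam j = m + 1).card := by
      rw [Finset.card_filter, Finset.card_filter, Finset.mul_sum, ← Finset.sum_add_distrib,
        ← Finset.sum_add_distrib]
      refine Finset.sum_congr rfl fun j _ => ?_
      split_ifs <;> omega
    rw [h3, Nat.even_add, Nat.even_add] at h1
    exact h1.1 ((iff_true_right (even_two_mul _)).2 h2)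

end SkewForms

/-! ### The centralizer `𝔤̄^f` -/

/-- The index of the block `V[i]` that contains `V_j`. -/
def blockIndex (k' j : ℕ) : ℕ := if j ≤ k' then (j + 1) / 2 else 0

section Blocks

variable {𝕜 : Type*} [Field 𝕜] {V : Type*} [AddCommGroup V] [Module 𝕜 V]
  {B : LinearMap.BilinForm 𝕜 V} {e f : skewAdjointLieSubalgebra B} {lam : ℕ → ℕ} {k k' : ℕ}
  {U : ℕ → Submodule 𝕜 V} {v : ℕ → V}
  {b : Module.Basis (Σ j : Finset.Icc 1 k, Fin (lam j)) 𝕜 V}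

theorem le_blockSpace (U : ℕ → Submodule 𝕜 V) {j : ℕ} (hj : j ∈ Finset.Icc 1 k) :
    U j ≤ blockSpace U k k' (blockIndex k' j) := by
  rw [Finset.mem_Icc] at hj
  rw [blockIndex]
  split_ifs with h
  · rw [blockSpace, if_neg (by omega)]
    rcases Nat.even_or_odd' j with ⟨r, hr | hr⟩
    · rw [show 2 * ((j + 1) / 2) = j by omega]
      exact le_sup_right
    · rw [show 2 * ((j + 1) / 2) - 1 = j by omega]
      exact le_sup_left
  · rw [blockSpace, if_pos rfl]
    exact le_iSup₂_of_le j (Finset.mem_Icc.2 (by omega)) le_rfl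

theorem blockIndex_le (h : Even k') (j : ℕ) : blockIndex k' j ≤ k' / 2 := by
  obtain ⟨r, rfl⟩ := h
  rw [blockIndex]
  split_ifs <;> omega

/-- The assumptions on the form and the decomposition that are used for the computations in
`𝔤̄^f`. -/
structure IsOrthChainBasis (B : LinearMap.BilinForm 𝕜 V) (e f : skewAdjointLieSubalgebra B)
    (lam : ℕ → ℕ) (k k' : ℕ) (U : ℕ → Submodule 𝕜 V) (v : ℕ → V)
    (b : Module.Basis (Σ j : Finset.Icc 1 k, Fin (lam j)) 𝕜 V) : Prop
    extends IsChainBasis (e : Module.End 𝕜 V) (f : Module.End 𝕜 V) lam k U v b where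
  symm : B.IsSymm
  nondeg : ∀ x, (∀ y, B x y = 0) → x = 0
  head : PairedHead lam k k'
  orth : ∀ i ∈ Finset.Icc 1 k, ∀ j ∈ Finset.Icc 1 k, blockIndex k' i ≠ blockIndex k' j →
    ∀ x ∈ U i, ∀ y ∈ U j, B x y = 0

theorem IsAdaptedDecomposition.exists_isOrthChainBasis [IsAlgClosed 𝕜] [CharZero 𝕜]
    [FiniteDimensional 𝕜 V] (hB : B.IsSymm) (hBn : B.Nondegenerate)
    {h : skewAdjointLieSubalgebra B} (ht : IsSl2Triple h e f) (hstar : StarCondition lam k k')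
    {U : ℕ → LieSubmodule 𝕜 (tripleSpan e h f) V}
    (hU : IsAdaptedDecomposition e h f lam k k' U) :
    ∃ (v : ℕ → V) (b : Module.Basis (Σ j : Finset.Icc 1 k, Fin (lam j)) 𝕜 V),
      IsOrthChainBasis B e f lam k k' (asSubspaces U) v b := by
  obtain ⟨v, b, hb⟩ := hU.exists_isChainBasis ht
  have hhead := hstar.pairedHead
    (fun i h1 h2 => hb.pos ⟨i, Finset.mem_Icc.2 ⟨h1, h2⟩⟩) hU.anti
    fun a ha => hb.even_multiplicity hBn.1 hB ha
  refine ⟨v, b, hb, hB, hBn.1, hhead, fun i hi j hj hij x hx y hy => ?_⟩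
  exact hU.orthogonal _ (blockIndex_le hhead.even_length i) _ (blockIndex_le hhead.even_length j)
    hij x (le_blockSpace _ hi hx) y (le_blockSpace _ hj hy)

namespace IsOrthChainBasis

variable (hb : IsOrthChainBasis B e f lam k k' U v b)
include hb

theorem basis_mem (p : Σ j : Finset.Icc 1 k, Fin (lam j)) : b p ∈ U p.1 := by
  rw [hb.mem_iff]
  intro q hq
  rw [Module.Basis.repr_self, Finsupp.single_apply, if_neg]
  rintro rfl
  exact hq rfl

theorem basis_chainBot {j : ℕ} (hj : j ∈ Finset.Icc 1 k) :
    b (chainBot (d := fun j : Finset.Icc 1 k => lam j) hb.pos ⟨j, hj⟩) = v j := by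
  rw [hb.apply]
  simp [chainBot]

theorem basis_chainTop {j : ℕ} (hj : j ∈ Finset.Icc 1 k) :
    b (chainTop (d := fun j : Finset.Icc 1 k => lam j) hb.pos ⟨j, hj⟩) =
      ((e : Module.End 𝕜 V) ^ (lam j - 1)) (v j) := by
  rw [hb.apply]
  simp [chainTop]

theorem chainTop_mem (j : Finset.Icc 1 k) : ((e : Module.End 𝕜 V) ^ (lam j - 1)) (v j) ∈ U j := by
  have h := hb.basis_mem (chainTop (d := fun j : Finset.Icc 1 k => lam j) hb.pos j)
  rw [hb.basis_chainTop j.2] at h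
  exact h

/-- The entry of the matrix of `y` that sends the last vector of the `j`-th chain to the first
vector of the `i`-th chain. -/
noncomputable def cornerEntry (y : Module.End 𝕜 V) (i j : Finset.Icc 1 k) : 𝕜 :=
  b.repr (y (((e : Module.End 𝕜 V) ^ (lam j - 1)) (v j)))
    (chainBot (d := fun j : Finset.Icc 1 k => lam j) hb.pos i)

theorem toMatrix_corner (y : Module.End 𝕜 V) (i j : Finset.Icc 1 k) :
    LinearMap.toMatrix b b y (chainBot (d := fun j : Finset.Icc 1 k => lam j) hb.pos i)
      (chainTop (d := fun j : Finset.Icc 1 k => lam j) hb.pos j) = hb.cornerEntry y i j := by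
  rw [LinearMap.toMatrix_apply, hb.basis_chainTop j.2]
  rfl

/-- The two chains of a block pair only through the first vector of one chain and the last vector
of the other one. -/
theorem form_chainTop [CharZero 𝕜] {i j : Finset.Icc 1 k} (hij : (i : ℕ) ≠ j)
    (hj : (j : ℕ) ≤ k') (hblock : blockIndex k' i = blockIndex k' j) (x : V) :
    B x (((e : Module.End 𝕜 V) ^ (lam j - 1)) (v j)) =
      b.repr x (chainBot (d := fun j : Finset.Icc 1 k => lam j) hb.pos i) *
        B (v i) (((e : Module.End 𝕜 V) ^ (lam j - 1)) (v j)) := by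
  have hj1 := Finset.mem_Icc.1 j.2
  have hi1 := Finset.mem_Icc.1 i.2
  conv_lhs => rw [← b.sum_repr x]
  rw [LinearMap.BilinForm.sum_left,
    Finset.sum_eq_single (chainBot (d := fun j : Finset.Icc 1 k => lam j) hb.pos i)]
  · rw [LinearMap.BilinForm.smul_left, hb.basis_chainBot i.2]
  -- Other blocks are orthogonal to `V_j`. At positions `a ≥ 1`, moving `e^a` across the form gives
  -- a power of `e` that kills `v_j`. Finally `v_j` itself drops out because `λ_j - 1` is odd.
  · intro p _ hp
    rw [LinearMap.BilinForm.smul_left]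
    refine mul_eq_zero_of_right _ ?_
    by_cases h1 : blockIndex k' p.1 = blockIndex k' j
    · by_cases h2 : (p.2 : ℕ) = 0
      · by_cases h3 : p.1 = j
        · have hev := hb.head.even j hj1.1 hj
          have hpos := hb.pos j
          have hodd : Odd (lam j - 1) := by
            obtain ⟨r, hr⟩ := hev
            exact ⟨r - 1, by omega⟩
          rw [hb.apply, h2, h3]
          exact skewAdjoint_odd_pow_apply_self hb.symm e hodd _
        · exfalso
          have h4 : p.1 ≠ i := fun h4 => hp (chain_ext h4 h2)
          have h5 : ((p.1 : Finset.Icc 1 k) : ℕ) ≠ i := fun h => h4 (Subtype.ext h)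
          have h6 : ((p.1 : Finset.Icc 1 k) : ℕ) ≠ j := fun h => h3 (Subtype.ext h)
          have h7 := Finset.mem_Icc.1 p.1.2
          simp only [blockIndex, if_pos hj] at h1 hblock
          split_ifs at h1 hblock <;> omega
      · rw [hb.apply, skewAdjoint_pow_apply, ← Module.End.mul_apply, ← pow_add,
          hb.pow_apply_eq_zero j.2 (by omega), map_zero, mul_zero]
    · exact hb.orth _ p.1.2 _ j.2 h1 _ (hb.basis_mem p) _ (hb.chainTop_mem j)
  · simp

theorem form_ne_zero [CharZero 𝕜] {i j : Finset.Icc 1 k} (hij : (i : ℕ) ≠ j)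
    (hj : (j : ℕ) ≤ k') (hblock : blockIndex k' i = blockIndex k' j) :
    B (v i) (((e : Module.End 𝕜 V) ^ (lam j - 1)) (v j)) ≠ 0 := by
  intro h0
  have h1 : ((e : Module.End 𝕜 V) ^ (lam j - 1)) (v j) = 0 := by
    refine hb.nondeg _ fun y => ?_
    rw [hb.symm.eq, hb.form_chainTop hij hj hblock, h0, mul_zero]
  rw [← hb.basis_chainTop j.2] at h1
  exact b.ne_zero _ h1

/-- With `w` the last vector of the chain `j`, `B (y w) w = 0` by skew-adjointness, and the
left-hand side is the corner entry times a nonzero scalar. -/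
theorem cornerEntry_eq_zero_of_pair [CharZero 𝕜] (y : skewAdjointLieSubalgebra B)
    {i j : Finset.Icc 1 k} (hij : (i : ℕ) ≠ j) (hj : (j : ℕ) ≤ k')
    (hblock : blockIndex k' i = blockIndex k' j) :
    hb.cornerEntry (y : Module.End 𝕜 V) i j = 0 := by
  have h := hb.form_chainTop hij hj hblock
    ((y : Module.End 𝕜 V) (((e : Module.End 𝕜 V) ^ (lam j - 1)) (v j)))
  have h2 := skewAdjoint_odd_pow_apply_self hb.symm y odd_one
    (((e : Module.End 𝕜 V) ^ (lam j - 1)) (v j))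
  rw [hb.symm.eq, pow_one, h] at h2
  exact (mul_eq_zero.1 h2).resolve_right (hb.form_ne_zero hij hj hblock)

/-- Two signs cancel: one from moving `y` across the form, one from moving `e^(λ_i - 1)`, an odd
power. -/
theorem cornerEntry_pair_eq [CharZero 𝕜] (y : skewAdjointLieSubalgebra B)
    {i j : Finset.Icc 1 k} (hij : (i : ℕ) ≠ j) (hi : (i : ℕ) ≤ k') (hj : (j : ℕ) ≤ k')
    (hblock : blockIndex k' i = blockIndex k' j) :
    hb.cornerEntry (y : Module.End 𝕜 V) i i = hb.cornerEntry (y : Module.End 𝕜 V) j j := by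
  have hi1 := Finset.mem_Icc.1 i.2
  have hj1 := Finset.mem_Icc.1 j.2
  have hlam : lam i = lam j := by
    simp only [blockIndex, if_pos hi, if_pos hj] at hblock
    rcases Nat.even_or_odd' (i : ℕ) with ⟨r, hr | hr⟩
    · have h := hb.head.pair r (by omega) (by omega)
      rw [hr, ← h]
      congr 1
      omega
    · obtain ⟨n, hn⟩ := hb.head.even_length
      have h := hb.head.pair (r + 1) (by omega) (by omega)
      rw [show 2 * (r + 1) - 1 = (i : ℕ) by omega, show 2 * (r + 1) = (j : ℕ) by omega] at h
      exact h
  have h1 := hb.form_chainTop hij hj hblock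
    ((y : Module.End 𝕜 V) (((e : Module.End 𝕜 V) ^ (lam i - 1)) (v i)))
  have h2 := hb.form_chainTop hij.symm hi hblock.symm
    ((y : Module.End 𝕜 V) (((e : Module.End 𝕜 V) ^ (lam j - 1)) (v j)))
  have hodd : Odd (lam i - 1) := by
    have hpos := hb.pos i
    obtain ⟨r, hr⟩ := hb.head.even i hi1.1 hi
    exact ⟨r - 1, by omega⟩
  have h3 : B (v j) (((e : Module.End 𝕜 V) ^ (lam i - 1)) (v i)) =
      -B (v i) (((e : Module.End 𝕜 V) ^ (lam j - 1)) (v j)) := by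
    rw [hb.symm.eq, skewAdjoint_pow_apply, hodd.neg_one_pow, neg_one_mul, hlam]
  have h4 : B ((y : Module.End 𝕜 V) (((e : Module.End 𝕜 V) ^ (lam i - 1)) (v i)))
      (((e : Module.End 𝕜 V) ^ (lam j - 1)) (v j)) =
      -B ((y : Module.End 𝕜 V) (((e : Module.End 𝕜 V) ^ (lam j - 1)) (v j)))
        (((e : Module.End 𝕜 V) ^ (lam i - 1)) (v i)) := by
    rw [skewAdjoint_apply, hb.symm.eq]
  rw [h1, h2, h3, mul_neg, neg_neg] at h4
  exact mul_right_cancel₀ (hb.form_ne_zero hij hj hblock) h4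

theorem repr_eq_zero_of_mem_blockSpace {l : ℕ} (hl : 1 ≤ l) (hlk : 2 * l ≤ k') {x : V}
    (hx : x ∈ blockSpace U k k' l) {p : Σ j : Finset.Icc 1 k, Fin (lam j)}
    (hp : blockIndex k' p.1 ≠ l) : b.repr x p = 0 := by
  have hle := hb.head.le
  rw [blockSpace, if_neg (by omega), Submodule.mem_sup] at hx
  obtain ⟨x1, h1, x2, h2, rfl⟩ := hx
  have h3 := (hb.mem_iff ⟨2 * l - 1, Finset.mem_Icc.2 (by omega)⟩ x1).1 h1 p fun h => hp (by
    have h4 := congrArg Subtype.val h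
    simp only at h4
    rw [blockIndex, h4, if_pos (by omega)]
    omega)
  have h4 := (hb.mem_iff ⟨2 * l, Finset.mem_Icc.2 (by omega)⟩ x2).1 h2 p fun h => hp (by
    have h4 := congrArg Subtype.val h
    simp only at h4
    rw [blockIndex, h4, if_pos (by omega)]
    omega)
  rw [map_add, Finsupp.add_apply, h3, h4, add_zero]

theorem cornerEntry_eq_zero [CharZero 𝕜] {y : skewAdjointLieSubalgebra B} (hy : y ∈ gBar B U k k')
    {i j : Finset.Icc 1 k} (hij : i ≠ j) (hj : (j : ℕ) ≤ k') :
    hb.cornerEntry (y : Module.End 𝕜 V) i j = 0 := by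
  have hj1 := Finset.mem_Icc.1 j.2
  by_cases hblock : blockIndex k' i = blockIndex k' j
  · exact hb.cornerEntry_eq_zero_of_pair y (fun h => hij (Subtype.ext h)) hj hblock
  · obtain ⟨n, hn⟩ := hb.head.even_length
    have hmem : ((e : Module.End 𝕜 V) ^ (lam j - 1)) (v j) ∈
        blockSpace U k k' (blockIndex k' j) := by
      exact le_blockSpace U j.2 (hb.chainTop_mem j)
    refine hb.repr_eq_zero_of_mem_blockSpace (l := blockIndex k' j) ?_ ?_
      (hy _ (blockIndex_le hb.head.even_length _) _ hmem) hblock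
    · rw [blockIndex, if_pos hj]; omega
    · rw [blockIndex, if_pos hj]; omega

end IsOrthChainBasis

end Blocks

/-! ### The functions `z_l` as corner entries, and the small determinant on `𝔤̄^f` -/

section ZFunctions

variable {𝕜 : Type*} [Field 𝕜] {V : Type*} [AddCommGroup V] [Module 𝕜 V]
  {B : LinearMap.BilinForm 𝕜 V} {e f : skewAdjointLieSubalgebra B} {lam : ℕ → ℕ} {k k' : ℕ}
  {U : ℕ → Submodule 𝕜 V} {v : ℕ → V}
  {b : Module.Basis (Σ j : Finset.Icc 1 k, Fin (lam j)) 𝕜 V}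

namespace IsOrthChainBasis

variable (hb : IsOrthChainBasis B e f lam k k' U v b)
include hb

theorem epsEnd_basis
    (hcompl : ∀ j ∈ Finset.Icc 1 k, IsCompl (U j) (⨆ l ∈ (Finset.Icc 1 k).erase j, U l))
    (j : Finset.Icc 1 k) (p : Σ j : Finset.Icc 1 k, Fin (lam j)) :
    epsEnd e lam k U j (b p) =
      if p = chainBot (d := fun j : Finset.Icc 1 k => lam j) hb.pos j then
        ((e : Module.End 𝕜 V) ^ (lam j - 1)) (v j) else 0 := by
  rw [epsEnd, Module.End.mul_apply, summandProj, dif_pos (hcompl j j.2)]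
  by_cases hp : p.1 = j
  · rw [Submodule.projection_apply_of_mem_left _ (hp ▸ hb.basis_mem p), hb.apply,
      ← Module.End.mul_apply, ← pow_add]
    by_cases h0 : (p.2 : ℕ) = 0
    · rw [if_pos (chain_ext hp h0), h0, add_zero, hp]
    · rw [if_neg (fun h => h0 (by rw [h]; rfl)), hb.pow_apply_eq_zero p.1.2]
      rw [← hp]
      omega
  · rw [(Submodule.projection_apply_eq_zero_iff _).2, map_zero, if_neg]
    · rintro rfl
      exact hp rfl
    · have h1 : U p.1 ≤ ⨆ l ∈ (Finset.Icc 1 k).erase (j : ℕ), U l :=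
        le_iSup₂_of_le (f := fun (i : ℕ) (_ : i ∈ (Finset.Icc 1 k).erase (j : ℕ)) => U i) p.1
          (Finset.mem_erase.2 ⟨fun h => hp (Subtype.ext h), p.1.2⟩) le_rfl
      exact h1 (hb.basis_mem p)

theorem trace_epsEnd_mul
    (hcompl : ∀ j ∈ Finset.Icc 1 k, IsCompl (U j) (⨆ l ∈ (Finset.Icc 1 k).erase j, U l))
    (j : Finset.Icc 1 k) (y : Module.End 𝕜 V) :
    LinearMap.trace 𝕜 V (epsEnd e lam k U j * y) = hb.cornerEntry y j j := by
  rw [LinearMap.trace_mul_comm, LinearMap.trace_eq_matrix_trace 𝕜 b, Matrix.trace,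
    Finset.sum_eq_single (chainBot (d := fun j : Finset.Icc 1 k => lam j) hb.pos j)]
  · rw [Matrix.diag_apply, LinearMap.toMatrix_apply, Module.End.mul_apply, hb.epsEnd_basis hcompl,
      if_pos rfl]
    rfl
  · intro p _ hp
    rw [Matrix.diag_apply, LinearMap.toMatrix_apply, Module.End.mul_apply, hb.epsEnd_basis hcompl,
      if_neg hp, map_zero, map_zero]
    rfl
  · simp

/-- The trace against `ε_j` picks out the `j`-th diagonal corner entry. The two entries of a pair
are equal, so the factor `1/2` in the invariant form makes `z_l` their common value. -/
theorem zFun_eq [CharZero 𝕜]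
    (hcompl : ∀ j ∈ Finset.Icc 1 k, IsCompl (U j) (⨆ l ∈ (Finset.Icc 1 k).erase j, U l))
    (y : gBarCentralizer f U k k') {j : Finset.Icc 1 k} (hj : (j : ℕ) ≤ k') :
    hb.cornerEntry ((y : skewAdjointLieSubalgebra B) : Module.End 𝕜 V) j j =
      zFun e f lam k k' U (((j : ℕ) + 1) / 2) y := by
  have hj1 := Finset.mem_Icc.1 j.2
  obtain ⟨n, hn⟩ := hb.head.even_length
  obtain ⟨l, hl⟩ : ∃ l, ((j : ℕ) + 1) / 2 = l := ⟨_, rfl⟩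
  have hle := hb.head.le
  have hm1 : 2 * l - 1 ∈ Finset.Icc 1 k := Finset.mem_Icc.2 (by omega)
  have hm2 : 2 * l ∈ Finset.Icc 1 k := Finset.mem_Icc.2 (by omega)
  have h1 := hb.cornerEntry_pair_eq (y : skewAdjointLieSubalgebra B)
    (i := ⟨2 * l - 1, hm1⟩) (j := ⟨2 * l, hm2⟩) (by simp only; omega) (by simp only; omega)
    (by simp only; omega) (by
      simp only [blockIndex]; rw [if_pos (by omega), if_pos (by omega)]; omega)
  rw [hl, zFun, zEnd, add_mul, map_add, hb.trace_epsEnd_mul hcompl ⟨2 * l - 1, hm1⟩,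
    hb.trace_epsEnd_mul hcompl ⟨2 * l, hm2⟩, h1]
  rw [← two_mul, mul_div_cancel_left₀ _ two_ne_zero]
  rcases Nat.even_or_odd' (j : ℕ) with ⟨r, hr | hr⟩
  · have : j = ⟨2 * l, hm2⟩ := Subtype.ext (by simp only; omega)
    rw [this]
  · have : j = ⟨2 * l - 1, hm1⟩ := Subtype.ext (by simp only; omega)
    rw [this, h1]

/-- The endomorphism that equals `g j • f ^ (λ_j - 1)` on `V_j` lies in `𝔤̄^f`, for suitable `g`. -/
theorem exists_gBarCentralizer (g : ℕ → 𝕜) (hg : ∀ j, k' < j → g j = 0)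
    (hg2 : ∀ i j, blockIndex k' i = blockIndex k' j → g i = g j) :
    ∃ y : gBarCentralizer f U k k', ∀ j ∈ Finset.Icc 1 k, ∀ x ∈ U j,
      ((y : skewAdjointLieSubalgebra B) : Module.End 𝕜 V) x =
        g j • ((f : Module.End 𝕜 V) ^ (lam j - 1)) x := by
  have hfpow : ∀ (n : ℕ) (j : Finset.Icc 1 k), ∀ x ∈ U j, ((f : Module.End 𝕜 V) ^ n) x ∈ U j := by
    intro n j x hx
    induction n with
    | zero => exact hx
    | succ n ih => rw [pow_succ', Module.End.mul_apply]; exact hb.f_mem j _ ih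
  let y0 : Module.End 𝕜 V := b.constr 𝕜 fun p =>
    g p.1 • ((f : Module.End 𝕜 V) ^ (lam p.1 - 1)) (b p)
  have hy0b : ∀ p, y0 (b p) = g p.1 • ((f : Module.End 𝕜 V) ^ (lam p.1 - 1)) (b p) := fun p =>
    b.constr_basis 𝕜 _ p
  have hy0 : ∀ j : Finset.Icc 1 k, ∀ x ∈ U j,
      y0 x = g j • ((f : Module.End 𝕜 V) ^ (lam j - 1)) x := by
    intro j x hx
    rw [hb.mem_iff] at hx
    rw [← b.sum_repr x, map_sum, map_sum, Finset.smul_sum]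
    refine Finset.sum_congr rfl fun p _ => ?_
    by_cases hp : p.1 = j
    · rw [map_smul, map_smul, hy0b, hp, smul_comm]
    · rw [hx p hp, zero_smul, map_zero, map_zero, smul_zero]
  have hmem : ∀ j : Finset.Icc 1 k, ∀ x ∈ U j, y0 x ∈ U j := by
    intro j x hx
    rw [hy0 j x hx]
    exact (U j).smul_mem _ (hfpow _ j x hx)
  -- Within a block of the head both chains have the same length `λ` and the same scalar, and `λ -
  -- 1` is odd, so the power of `f` is skew-adjoint; on `V[0]` the map is zero.
  have hskew : B.IsSkewAdjoint y0 := by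
    have h : B.compl₁₂ y0 LinearMap.id = B.compl₁₂ LinearMap.id (-y0) := by
      refine LinearMap.BilinForm.ext_basis b fun p q => ?_
      simp only [LinearMap.compl₁₂_apply, LinearMap.id_apply, LinearMap.neg_apply, map_neg]
      by_cases hpq : blockIndex k' p.1 = blockIndex k' q.1
      · have hp1 := Finset.mem_Icc.1 p.1.2
        have hq1 := Finset.mem_Icc.1 q.1.2
        by_cases hpk : ((p.1 : Finset.Icc 1 k) : ℕ) ≤ k'
        · have hqk : ((q.1 : Finset.Icc 1 k) : ℕ) ≤ k' := by
            by_contra h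
            simp only [blockIndex, if_pos hpk, if_neg h] at hpq
            omega
          have hlam : lam p.1 = lam q.1 := by
            by_cases hne : ((p.1 : Finset.Icc 1 k) : ℕ) = q.1
            · rw [hne]
            · obtain ⟨n, hn⟩ := hb.head.even_length
              simp only [blockIndex, if_pos hpk, if_pos hqk] at hpq
              have h := hb.head.pair (((p.1 : Finset.Icc 1 k) + 1) / 2) (by omega) (by omega)
              rcases Nat.even_or_odd' ((p.1 : Finset.Icc 1 k) : ℕ) with ⟨r, hr | hr⟩
              · rw [show 2 * ((((p.1 : Finset.Icc 1 k) : ℕ) + 1) / 2) - 1 = q.1 by omega,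
                  show 2 * ((((p.1 : Finset.Icc 1 k) : ℕ) + 1) / 2) = p.1 by omega] at h
                exact h.symm
              · rw [show 2 * ((((p.1 : Finset.Icc 1 k) : ℕ) + 1) / 2) - 1 = p.1 by omega,
                  show 2 * ((((p.1 : Finset.Icc 1 k) : ℕ) + 1) / 2) = q.1 by omega] at h
                exact h
          have hodd : Odd (lam q.1 - 1) := by
            have hpos := hb.pos q.1
            obtain ⟨r, hr⟩ := hb.head.even q.1 hq1.1 hqk
            exact ⟨r - 1, by omega⟩
          rw [hy0b, hy0b, hlam, hg2 _ _ hpq, LinearMap.BilinForm.smul_left,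
            LinearMap.BilinForm.smul_right, skewAdjoint_pow_apply, hodd.neg_one_pow]
          ring
        · have hqk : ¬ ((q.1 : Finset.Icc 1 k) : ℕ) ≤ k' := by
            intro h
            simp only [blockIndex, if_pos h, if_neg hpk] at hpq
            omega
          rw [hy0b, hy0b, hg _ (not_le.1 hpk), hg _ (not_le.1 hqk)]
          simp
      · rw [hb.orth _ p.1.2 _ q.1.2 hpq _ (hmem _ _ (hb.basis_mem p)) _ (hb.basis_mem q),
          hb.orth _ p.1.2 _ q.1.2 hpq _ (hb.basis_mem p) _ (hmem _ _ (hb.basis_mem q)), neg_zero]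
    intro x y
    exact LinearMap.congr_fun (LinearMap.congr_fun h x) y
  let y1 : skewAdjointLieSubalgebra B := ⟨y0, (LinearMap.mem_skewAdjointSubmodule y0).2 hskew⟩
  have hcomm : (f : Module.End 𝕜 V) * y0 = y0 * f := by
    refine b.ext fun p => ?_
    rw [Module.End.mul_apply, Module.End.mul_apply, hy0b,
      hy0 p.1 _ (hb.f_mem p.1 _ (hb.basis_mem p)), map_smul, ← Module.End.mul_apply,
      ← Module.End.mul_apply, ← pow_succ, ← pow_succ']
  have h1 : y1 ∈ centralizerOf f := by
    rw [LinearMap.mem_ker, LieAlgebra.ad_apply]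
    refine Subtype.ext ?_
    exact sub_eq_zero.2 hcomm
  have h2 : y1 ∈ gBar B U k k' := by
    intro i hi x hx
    have hle := hb.head.le
    have hsub : blockSpace U k k' i ≤ (blockSpace U k k' i).comap y0 := by
      have hj : ∀ j ∈ Finset.Icc 1 k, U j ≤ blockSpace U k k' i →
          U j ≤ (blockSpace U k k' i).comap y0 := fun j hj h w hw => h (hmem ⟨j, hj⟩ w hw)
      by_cases h0 : i = 0
      · subst h0
        conv_lhs => rw [blockSpace, if_pos rfl]
        refine iSup₂_le fun j hjm => hj j ?_ ?_
        · rw [Finset.mem_Icc] at hjm ⊢; omega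
        · rw [blockSpace, if_pos rfl]
          exact le_iSup₂_of_le j hjm le_rfl
      · conv_lhs => rw [blockSpace, if_neg h0]
        refine sup_le (hj _ ?_ ?_) (hj _ ?_ ?_)
        · rw [Finset.mem_Icc]; omega
        · rw [blockSpace, if_neg h0]; exact le_sup_left
        · rw [Finset.mem_Icc]; omega
        · rw [blockSpace, if_neg h0]; exact le_sup_right
    exact hsub hx
  exact ⟨⟨y1, h1, h2⟩, fun j hj x hx => hy0 ⟨j, hj⟩ x hx⟩

theorem exists_zFun_eq_one [CharZero 𝕜]
    (hcompl : ∀ j ∈ Finset.Icc 1 k, IsCompl (U j) (⨆ l ∈ (Finset.Icc 1 k).erase j, U l)) :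
    ∃ y : gBarCentralizer f U k k', ∀ l, 1 ≤ l → 2 * l ≤ k' → zFun e f lam k k' U l y = 1 := by
  choose c hc0 hc using hb.f_pow
  have hle := hb.head.le
  obtain ⟨n, hn⟩ := hb.head.even_length
  -- The inverse of the scalar by which `f^(λ-1) e^(λ-1)` acts on `v_{2l}` normalizes the corner
  -- entry of the second chain of the pair to `1`.
  let g' : ℕ → 𝕜 := fun l =>
    if h : l ≠ 0 ∧ 2 * l ≤ k' then (c ⟨2 * l, Finset.mem_Icc.2 (by omega)⟩)⁻¹ else 0
  obtain ⟨y, hy⟩ := hb.exists_gBarCentralizer (fun j => g' (blockIndex k' j))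
    (fun j hj => by simp [blockIndex, not_le.2 hj, g']) (fun i j hij => by simp only [hij])
  refine ⟨y, fun l hl1 hl2 => ?_⟩
  have hm : 2 * l ∈ Finset.Icc 1 k := Finset.mem_Icc.2 (by omega)
  have h1 := hb.zFun_eq hcompl y (j := ⟨2 * l, hm⟩) hl2
  rw [show (2 * l + 1) / 2 = l by omega] at h1
  have hbi : blockIndex k' (2 * l) = l := by
    rw [blockIndex, if_pos hl2]; omega
  rw [← h1, cornerEntry, hy (2 * l) hm _ (hb.chainTop_mem ⟨2 * l, hm⟩), hc ⟨2 * l, hm⟩, hbi]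
  simp only [g']
  rw [dif_pos ⟨by omega, hl2⟩, smul_smul, inv_mul_cancel₀ (hc0 _), one_smul,
    ← hb.basis_chainBot hm, Module.Basis.repr_self, Finsupp.single_eq_same]

/-- For `c` above the tail, the columns `j > k'` are columns of the identity, so the unknown corner
entries inside `V[0]` play no role; the remaining columns are diagonal on `𝔤̄^f`. -/
theorem det_chainCorner [CharZero 𝕜]
    (hcompl : ∀ j ∈ Finset.Icc 1 k, IsCompl (U j) (⨆ l ∈ (Finset.Icc 1 k).erase j, U l))
    (y : gBarCentralizer f U k k') {c : ℕ} (hc : ∀ j, k' < j → j ≤ k → lam j < c) :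
    (chainCorner (d := fun j : Finset.Icc 1 k => lam j) hb.pos c (X : 𝕜[X])
      ((LinearMap.toMatrix b b
        ((y : skewAdjointLieSubalgebra B) : Module.End 𝕜 V)).map C)).det =
      ∏ j ∈ Finset.Icc 1 k, ((if lam j ≤ c then 1 else 0) -
        (if c ≤ lam j then X * C (zFun e f lam k k' U ((j + 1) / 2) y) else 0)) := by
  rw [← Finset.prod_coe_sort, ← Matrix.det_diagonal]
  congr 1
  ext1 i j
  have hj1 := Finset.mem_Icc.1 j.2
  simp only [chainCorner, Matrix.of_apply, Matrix.map_apply, hb.toMatrix_corner,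
    Matrix.diagonal_apply]
  by_cases hjk : (j : ℕ) ≤ k'
  · by_cases hij : i = j
    · subst hij
      rw [hb.zFun_eq hcompl y hjk]
      simp
    · rw [hb.cornerEntry_eq_zero y.2.2 hij hjk]
      simp [hij]
  · have h := hc j (by omega) hj1.2
    rw [if_neg (c := c ≤ lam j) (by omega)]
    by_cases hij : i = j
    · subst hij
      simp [not_le.2 h]
    · simp [hij]

end IsOrthChainBasis

end ZFunctions

/-! ### Generating functions for the elementary symmetric functions -/

section GeneratingFunctions

theorem prod_Icc_two_mul {M : Type*} [CommMonoid M] (g : ℕ → M) (n : ℕ) :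
    ∏ j ∈ Finset.Icc 1 (2 * n), g j = ∏ l ∈ Finset.Icc 1 n, (g (2 * l - 1) * g (2 * l)) := by
  induction n with
  | zero => rfl
  | succ n ih =>
    rw [show 2 * (n + 1) = 2 * n + 1 + 1 by ring, Finset.prod_Icc_succ_top (by omega),
      Finset.prod_Icc_succ_top (by omega), Finset.prod_Icc_succ_top (by omega), ih, mul_assoc]
    rfl

theorem prod_Icc_split {M : Type*} [CommMonoid M] (g : ℕ → M) {m n : ℕ} (h : m ≤ n) :
    ∏ l ∈ Finset.Icc 1 n, g l =
      (∏ l ∈ Finset.Icc 1 m, g l) * ∏ l ∈ Finset.Icc (m + 1) n, g l := by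
  rw [← Finset.prod_union]
  · congr 1
    ext j
    simp only [Finset.mem_union, Finset.mem_Icc]
    omega
  · rw [Finset.disjoint_left]
    intro j h1 h2
    rw [Finset.mem_Icc] at h1 h2
    omega

theorem coeff_prod_one_sub {R : Type*} [CommRing R] (I : Finset ℕ) (z : ℕ → R) (r : ℕ) :
    (∏ l ∈ I, (1 - X * C (z l))).coeff r =
      (-1) ^ r * ∑ t ∈ I.powersetCard r, ∏ l ∈ t, z l := by
  simp only [sub_eq_add_neg]
  rw [Finset.prod_one_add, finsetSum_coeff, Finset.powersetCard_eq_filter, Finset.sum_filter,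
    Finset.mul_sum]
  refine Finset.sum_congr rfl fun t _ => ?_
  have h : ∏ l ∈ t, (-(X * C (z l)) : R[X]) = C ((-1) ^ t.card * ∏ l ∈ t, z l) * X ^ t.card := by
    rw [Finset.prod_neg, Finset.prod_mul_distrib, Finset.prod_const, map_mul, map_pow, map_neg,
      map_one, map_prod]
    ring
  rw [h, coeff_C_mul_X_pow]
  by_cases hr : r = t.card
  · rw [if_pos hr, if_pos hr.symm, hr]
  · rw [if_neg hr, if_neg (Ne.symm hr), mul_zero]

theorem coeff_prod_one_sub_sq {R : Type*} [CommRing R] (I : Finset ℕ) (z : ℕ → R) (j : ℕ) :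
    ((∏ l ∈ I, (1 - X * C (z l))) ^ 2).coeff j =
      (-1) ^ j * ∑ r ∈ Finset.range (j + 1), (∑ t ∈ I.powersetCard (j - r), ∏ l ∈ t, z l) *
        ∑ t ∈ I.powersetCard r, ∏ l ∈ t, z l := by
  rw [sq, coeff_mul, Finset.Nat.sum_antidiagonal_eq_sum_range_succ_mk, Finset.mul_sum]
  refine Finset.sum_congr rfl fun r hr => ?_
  have hr' : r ≤ j := Nat.lt_succ_iff.1 (Finset.mem_range.1 hr)
  simp only [coeff_prod_one_sub]
  have h : (-1 : R) ^ j = (-1) ^ r * (-1) ^ (j - r) := by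
    rw [← pow_add, Nat.add_sub_cancel' hr']
  rw [h]
  ring

theorem coeff_one_sub_X_pow_ne_zero {F : Type*} [Field F] [CharZero F] {n j : ℕ} (h : j ≤ n) :
    ((1 - X : F[X]) ^ n).coeff j ≠ 0 := by
  have h1 : (1 - X : F[X]) = -(X + C (-1)) := by
    rw [map_neg, map_one]; ring
  rw [h1, neg_pow, ← C_1, ← C_neg, ← C_pow, coeff_C_mul, coeff_X_add_C_pow]
  refine mul_ne_zero (pow_ne_zero _ (neg_ne_zero.2 one_ne_zero))
    (mul_ne_zero (pow_ne_zero _ (neg_ne_zero.2 one_ne_zero)) ?_)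
  exact_mod_cast (Nat.choose_pos h).ne'

theorem multVal_pos (lam : ℕ → ℕ) (k' : ℕ) {s : ℕ} (hs : 1 ≤ s) (hsm : s ≤ numValues lam k') :
    1 ≤ multVal lam k' s := by
  have hlen : (((Finset.Icc 1 k').image lam).sort (fun a b => b ≤ a)).length = numValues lam k' :=
    Finset.length_sort _
  have hmem : muVal lam k' s ∈ (Finset.Icc 1 k').image lam := by
    rw [muVal, List.getD_eq_getElem _ _ (by omega), ← Finset.mem_sort (fun a b => b ≤ a)]
    exact List.getElem_mem _
  obtain ⟨i, hi, he⟩ := Finset.mem_image.1 hmem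
  rw [multVal, if_neg (by omega)]
  exact Finset.card_pos.2 ⟨i, Finset.mem_filter.2 ⟨hi, he⟩⟩

variable {lam : ℕ → ℕ} {k k' : ℕ}

theorem PairedHead.even_multVal (h : PairedHead lam k k') {s : ℕ} (hs : 1 ≤ s)
    (hsm : s ≤ numValues lam k') : Even (multVal lam k' s) := by
  obtain ⟨t, rfl⟩ : ∃ t, s = t + 1 := ⟨s - 1, by omega⟩
  have h1 := h.even_multSum hsm
  rw [multSum_succ, Nat.even_add] at h1
  exact h1.1 (h.even_multSum (by omega))

theorem PairedHead.card_indexSet (h : PairedHead lam k k') {s : ℕ} (hs : 1 ≤ s)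
    (hsm : s ≤ numValues lam k') : (indexSet lam k' s).card = multVal lam k' s / 2 := by
  obtain ⟨t, rfl⟩ : ∃ t, s = t + 1 := ⟨s - 1, by omega⟩
  obtain ⟨a, ha⟩ := h.even_multVal hs hsm
  obtain ⟨c, hc⟩ := h.even_multSum (s := t) (by omega)
  rw [indexSet, Nat.card_Icc, Nat.add_sub_cancel, multSum_succ]
  omega

theorem multSum_pred_add (lam : ℕ → ℕ) (k' : ℕ) {s : ℕ} (hs : 1 ≤ s) :
    multSum lam k' (s - 1) + multVal lam k' s = multSum lam k' s := by
  obtain ⟨t, rfl⟩ : ∃ t, s = t + 1 := ⟨s - 1, by omega⟩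
  rw [multSum_succ]
  rfl

/-- The elementary symmetric function of top degree is the full product over its index set, and
`I_1, …, I_s` tile an initial interval. -/
theorem PairedHead.prod_lt_indexSet {M : Type*} [CommSemiring M] (h : PairedHead lam k k')
    (z : ℕ → M) (s : ℕ) (hsm : s ≤ numValues lam k') :
    ∏ t ∈ Finset.Icc 1 s,
      (∑ u ∈ (indexSet lam k' t).powersetCard (multVal lam k' t / 2), ∏ l ∈ u, z l) =
      ∏ l ∈ Finset.Icc 1 (multSum lam k' s / 2), z l := by
  induction s with
  | zero => simp [multSum_zero]
  | succ s ih =>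
    have hle : multSum lam k' s / 2 ≤ multSum lam k' (s + 1) / 2 := by
      rw [multSum_succ]; omega
    rw [Finset.prod_Icc_succ_top (by omega), ih (by omega), prod_Icc_split z hle,
      ← h.card_indexSet (by omega) hsm, Finset.powersetCard_self, Finset.sum_singleton]
    rfl

/-- At the level `μ_s` the pair `(2l - 1, 2l)` contributes `(X z_l)^2` if its value exceeds `μ_s`,
`(1 - X z_l)^2` if it equals `μ_s`, and `1` if it is smaller; the tail contributes `1`. -/
theorem PairedHead.prod_corner {F : Type*} [Field F] (h : PairedHead lam k k') {s : ℕ}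
    (hs : 1 ≤ s) (hsm : s ≤ numValues lam k') (z : ℕ → F) :
    (∏ j ∈ Finset.Icc 1 k, ((if lam j ≤ muVal lam k' s then 1 else 0) -
        (if muVal lam k' s ≤ lam j then X * C (z ((j + 1) / 2)) else 0)) : F[X]) =
      X ^ multSum lam k' (s - 1) * (C ((∏ l ∈ Finset.Icc 1 (multSum lam k' (s - 1) / 2), z l) ^ 2) *
        (∏ l ∈ indexSet lam k' s, (1 - X * C (z l))) ^ 2) := by
  obtain ⟨n, hn⟩ := h.even_length
  obtain ⟨a, ha⟩ := h.even_multSum (s := s - 1) (by omega)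
  obtain ⟨c, hc⟩ := h.even_multSum hsm
  have hle := h.le
  have hMk := multSum_le lam k' hsm
  have hMM := multSum_pred_add lam k' hs
  set μ := muVal lam k' s with hμ
  have hM : ∀ i, 1 ≤ i → i ≤ k' → (i ≤ multSum lam k' s ↔ μ ≤ lam i) :=
    fun i h1 h2 => h.le_multSum_iff hs hsm h1 h2
  have hM' : ∀ i, 1 ≤ i → i ≤ k' → (i ≤ multSum lam k' (s - 1) ↔ μ < lam i) :=
    fun i h1 h2 => h.le_multSum_pred_iff hs hsm h1 h2
  have hpos := multVal_pos lam k' hs hsm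
  have htail : ∀ j, k' < j → j ≤ k → lam j < μ := by
    intro j h1 h2
    have h3 : lam (multSum lam k' s) ≤ μ := by
      by_contra h4
      have := (hM' (multSum lam k' s) (by omega) hMk).2 (by omega)
      omega
    have := h.tail_lt (multSum lam k' s) j (by omega) hMk h1 h2
    omega
  rw [prod_Icc_split _ hle]
  have hone : (∏ j ∈ Finset.Icc (k' + 1) k, ((if lam j ≤ μ then 1 else 0) -
        (if μ ≤ lam j then X * C (z ((j + 1) / 2)) else 0)) : F[X]) = 1 := by
    refine Finset.prod_eq_one fun j hj => ?_
    rw [Finset.mem_Icc] at hj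
    have := htail j (by omega) hj.2
    rw [if_pos (by omega), if_neg (by omega), sub_zero]
  have hkn : Finset.Icc 1 k' = Finset.Icc 1 (2 * n) := by rw [hn, two_mul]
  rw [hone, mul_one, hkn, prod_Icc_two_mul]
  rw [prod_Icc_split _ (show multSum lam k' (s - 1) / 2 ≤ n by omega)]
  have hsplit2 : ∀ g : ℕ → F[X], ∏ l ∈ Finset.Icc (multSum lam k' (s - 1) / 2 + 1) n, g l =
      (∏ l ∈ indexSet lam k' s, g l) * ∏ l ∈ Finset.Icc (multSum lam k' s / 2 + 1) n, g l := by
    intro g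
    rw [indexSet, ← Finset.prod_union]
    · congr 1
      ext j
      simp only [Finset.mem_union, Finset.mem_Icc]
      omega
    · rw [Finset.disjoint_left]
      intro j h1 h2
      rw [Finset.mem_Icc] at h1 h2
      omega
  rw [hsplit2]
  have hpair : ∀ l, 1 ≤ l → l ≤ n → lam (2 * l - 1) = lam (2 * l) ∧ (2 * l - 1 + 1) / 2 = l ∧
      (2 * l + 1) / 2 = l := fun l h1 h2 =>
    ⟨h.pair l h1 (by omega), by omega, by omega⟩
  have e1 : ∏ l ∈ Finset.Icc 1 (multSum lam k' (s - 1) / 2),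
      ((((if lam (2 * l - 1) ≤ μ then 1 else 0) -
        (if μ ≤ lam (2 * l - 1) then X * C (z ((2 * l - 1 + 1) / 2)) else 0)) : F[X]) *
      ((if lam (2 * l) ≤ μ then 1 else 0) -
        (if μ ≤ lam (2 * l) then X * C (z ((2 * l + 1) / 2)) else 0))) =
      X ^ multSum lam k' (s - 1) *
        C ((∏ l ∈ Finset.Icc 1 (multSum lam k' (s - 1) / 2), z l) ^ 2) := by
    have : ∏ l ∈ Finset.Icc 1 (multSum lam k' (s - 1) / 2), (X ^ 2 * C (z l) ^ 2 : F[X]) =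
        X ^ multSum lam k' (s - 1) *
        C ((∏ l ∈ Finset.Icc 1 (multSum lam k' (s - 1) / 2), z l) ^ 2) := by
      rw [Finset.prod_mul_distrib, Finset.prod_const, Nat.card_Icc, ← pow_mul, Finset.prod_pow,
        map_pow, map_prod]
      congr 2
      omega
    rw [← this]
    refine Finset.prod_congr rfl fun l hl => ?_
    rw [Finset.mem_Icc] at hl
    obtain ⟨h1, h2, h3⟩ := hpair l hl.1 (by omega)
    have h4 := (hM' (2 * l) (by omega) (by omega)).1 (by omega)
    rw [h1, h2, h3, if_neg (by omega), if_pos (by omega)]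
    ring
  have e2 : ∏ l ∈ indexSet lam k' s,
      ((((if lam (2 * l - 1) ≤ μ then 1 else 0) -
        (if μ ≤ lam (2 * l - 1) then X * C (z ((2 * l - 1 + 1) / 2)) else 0)) : F[X]) *
      ((if lam (2 * l) ≤ μ then 1 else 0) -
        (if μ ≤ lam (2 * l) then X * C (z ((2 * l + 1) / 2)) else 0))) =
      (∏ l ∈ indexSet lam k' s, (1 - X * C (z l))) ^ 2 := by
    rw [← Finset.prod_pow]
    refine Finset.prod_congr rfl fun l hl => ?_
    rw [indexSet, Finset.mem_Icc] at hl
    obtain ⟨h1, h2, h3⟩ := hpair l (by omega) (by omega)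
    have h4 := (hM (2 * l) (by omega) (by omega)).1 (by omega)
    have h5 := (hM' (2 * l) (by omega) (by omega)).not.1 (by omega)
    rw [h1, h2, h3, if_pos (by omega), if_pos (by omega)]
    ring
  have e3 : ∏ l ∈ Finset.Icc (multSum lam k' s / 2 + 1) n,
      ((((if lam (2 * l - 1) ≤ μ then 1 else 0) -
        (if μ ≤ lam (2 * l - 1) then X * C (z ((2 * l - 1 + 1) / 2)) else 0)) : F[X]) *
      ((if lam (2 * l) ≤ μ then 1 else 0) -
        (if μ ≤ lam (2 * l) then X * C (z ((2 * l + 1) / 2)) else 0))) = 1 := by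
    refine Finset.prod_eq_one fun l hl => ?_
    rw [Finset.mem_Icc] at hl
    obtain ⟨h1, h2, h3⟩ := hpair l (by omega) (by omega)
    have h4 := (hM (2 * l) (by omega) (by omega)).not.1 (by omega)
    rw [h1, h2, h3, if_pos (by omega), if_neg (by omega)]
    ring
  rw [e1, e2, e3, mul_one, mul_assoc]

end GeneratingFunctions

/-! ### Evaluation and nonvanishing of the initial components -/

section MainFormula

variable {𝕜 : Type*} [Field 𝕜] {V : Type*} [AddCommGroup V] [Module 𝕜 V]
  {B : LinearMap.BilinForm 𝕜 V} {e f : skewAdjointLieSubalgebra B} {lam : ℕ → ℕ} {k k' : ℕ}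
  {U : ℕ → Submodule 𝕜 V} {v : ℕ → V}
  {b : Module.Basis (Σ j : Finset.Icc 1 k, Fin (lam j)) 𝕜 V}

theorem PairedHead.eq_muVal (h : PairedHead lam k k') {s j : ℕ} (hs : 1 ≤ s)
    (hsm : s ≤ numValues lam k') (hj1 : 1 ≤ j) (hjk : j ≤ multVal lam k' s) :
    multSum lam k' (s - 1) + j ≤ k' ∧ lam (multSum lam k' (s - 1) + j) = muVal lam k' s := by
  have h1 := multSum_le lam k' hsm
  have h2 := multSum_pred_add lam k' hs
  refine ⟨by omega, le_antisymm ?_ ?_⟩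
  · exact not_lt.1 ((h.le_multSum_pred_iff hs hsm (by omega) (by omega)).not.1 (by omega))
  · exact (h.le_multSum_iff hs hsm (by omega) (by omega)).1 (by omega)

theorem PairedHead.tail_lt_muVal (h : PairedHead lam k k') {s : ℕ} (hs : 1 ≤ s)
    (hsm : s ≤ numValues lam k') (j : ℕ) (hj1 : k' < j) (hjk : j ≤ k) : lam j < muVal lam k' s := by
  obtain ⟨h1, h2⟩ := h.eq_muVal hs hsm le_rfl (multVal_pos lam k' hs hsm)
  rw [← h2]
  exact h.tail_lt _ j (by omega) h1 hj1 hjk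

theorem IsOrthChainBasis.cornerCoeff_eq [CharZero 𝕜]
    (hb : IsOrthChainBasis B e f lam k k' U v b)
    (hcompl : ∀ j ∈ Finset.Icc 1 k, IsCompl (U j) (⨆ l ∈ (Finset.Icc 1 k).erase j, U l))
    (y : gBarCentralizer f U k k') {s j : ℕ} (hs : 1 ≤ s) (hsm : s ≤ numValues lam k')
    (hj1 : 1 ≤ j) (hjk : j ≤ multVal lam k' s) :
    hb.toIsChainBasis.cornerCoeff ((y : skewAdjointLieSubalgebra B) : Module.End 𝕜 V)
        (multSum lam k' (s - 1) + j) =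
      (∏ l ∈ Finset.Icc 1 (multSum lam k' (s - 1) / 2), zFun e f lam k k' U l y) ^ 2 *
        ((∏ l ∈ indexSet lam k' s, (1 - X * C (zFun e f lam k k' U l y))) ^ 2).coeff j := by
  rw [IsChainBasis.cornerCoeff, (hb.head.eq_muVal hs hsm hj1 hjk).2,
    hb.det_chainCorner hcompl y (hb.head.tail_lt_muVal hs hsm),
    hb.head.prod_corner hs hsm fun l => zFun e f lam k k' U l y, add_comm, coeff_X_pow_mul,
    coeff_C_mul]

/-- Where all `z_l` equal `1`, the coefficient becomes that of degree `j ≤ k_s` in `(1 - X)^(k_s)`,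
a signed binomial coefficient. -/
theorem IsOrthChainBasis.exists_cornerCoeff_ne_zero [CharZero 𝕜]
    (hb : IsOrthChainBasis B e f lam k k' U v b)
    (hcompl : ∀ j ∈ Finset.Icc 1 k, IsCompl (U j) (⨆ l ∈ (Finset.Icc 1 k).erase j, U l))
    {s j : ℕ} (hs : 1 ≤ s) (hsm : s ≤ numValues lam k') (hj1 : 1 ≤ j)
    (hjk : j ≤ multVal lam k' s) :
    ∃ x : centralizerOf f, hb.toIsChainBasis.cornerCoeff
      ((x : skewAdjointLieSubalgebra B) : Module.End 𝕜 V) (multSum lam k' (s - 1) + j) ≠ 0 := by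
  obtain ⟨y, hy⟩ := hb.exists_zFun_eq_one hcompl
  refine ⟨⟨y, y.2.1⟩, ?_⟩
  have h1 := hb.cornerCoeff_eq hcompl y hs hsm hj1 hjk
  have hM := multSum_le lam k' hsm
  have hMM := multSum_pred_add lam k' hs
  have h2 : ∏ l ∈ Finset.Icc 1 (multSum lam k' (s - 1) / 2), zFun e f lam k k' U l y = 1 := by
    refine Finset.prod_eq_one fun l hl => ?_
    rw [Finset.mem_Icc] at hl
    exact hy l hl.1 (by omega)
  have h3 : ∏ l ∈ indexSet lam k' s, (1 - X * C (zFun e f lam k k' U l y)) =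
      (1 - X) ^ (multVal lam k' s / 2) := by
    rw [← hb.head.card_indexSet hs hsm, ← Finset.prod_const]
    refine Finset.prod_congr rfl fun l hl => ?_
    rw [indexSet, Finset.mem_Icc] at hl
    rw [hy l (by omega) (by omega), map_one, mul_one]
  obtain ⟨a, ha⟩ := hb.head.even_multVal hs hsm
  rw [h2, one_pow, one_mul, h3, ← pow_mul] at h1
  change hb.toIsChainBasis.cornerCoeff ((y : skewAdjointLieSubalgebra B) : Module.End 𝕜 V) _ ≠ 0
  rw [h1]
  exact coeff_one_sub_X_pow_ne_zero (by omega)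

end MainFormula

theorem proposition4p13 {𝕜 : Type*} [Field 𝕜] [IsAlgClosed 𝕜] [CharZero 𝕜]
    {V : Type*} [AddCommGroup V] [Module 𝕜 V] [FiniteDimensional 𝕜 V]
    (B : LinearMap.BilinForm 𝕜 V) (hBsymm : B.IsSymm) (hBnd : B.Nondegenerate)
    (ℓ : ℕ) (hℓ : Module.finrank 𝕜 V = 2 * ℓ + 1 ∨ Module.finrank 𝕜 V = 2 * ℓ)
    (pf : skewAdjointLieSubalgebra B → 𝕜)
    (hpf : Module.finrank 𝕜 V = 2 * ℓ →
      IsPolynomialFunction pf ∧ ∀ x, pf x ^ 2 = charCoeff (2 * ℓ) x)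
    (e h f : skewAdjointLieSubalgebra B) (htriple : IsSl2Triple h e f)
    (lam : ℕ → ℕ) (k k' : ℕ) (hstar : StarCondition lam k k')
    (U : ℕ → LieSubmodule 𝕜 (tripleSpan e h f) V)
    (hU : IsAdaptedDecomposition e h f lam k k' U)
    (s : ℕ) (hs1 : 1 ≤ s) (hsm : s ≤ numValues lam k')
    (j : ℕ) (hj1 : 1 ≤ j) (hjk : j ≤ multVal lam k' s) :
    pBar e f ℓ pf lam k k' (asSubspaces U) (multSum lam k' (s - 1) + j) =
        (-1) ^ j * pBar e f ℓ pf lam k k' (asSubspaces U) (multSum lam k' (s - 1)) *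
          ∑ r ∈ Finset.range (j + 1),
            sigmaFun e f lam k k' (asSubspaces U) s (j - r) *
              sigmaFun e f lam k k' (asSubspaces U) s r ∧
    pBar e f ℓ pf lam k k' (asSubspaces U) (multSum lam k' (s - 1) + j) =
        (-1) ^ j *
          (∏ t ∈ Finset.Icc 1 (s - 1),
            sigmaFun e f lam k k' (asSubspaces U) t (multVal lam k' t / 2)) ^ 2 *
          ∑ r ∈ Finset.range (j + 1),
            sigmaFun e f lam k k' (asSubspaces U) s (j - r) *
              sigmaFun e f lam k k' (asSubspaces U) s r := by
  obtain ⟨v, b, hb⟩ := hU.exists_isOrthChainBasis hBsymm hBnd htriple hstar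
  have hcompl : ∀ j ∈ Finset.Icc 1 k,
      IsCompl (asSubspaces U j) (⨆ l ∈ (Finset.Icc 1 k).erase j, asSubspaces U l) :=
    fun j hj => hU.isCompl hj
  have hsig : ∀ (t r : ℕ) (y : gBarCentralizer f (asSubspaces U) k k'),
      sigmaFun e f lam k k' (asSubspaces U) t r y =
        ∑ u ∈ (indexSet lam k' t).powersetCard r, ∏ l ∈ u,
          zFun e f lam k k' (asSubspaces U) l y := by
    intro t r y
    rw [sigmaFun, Finset.sum_apply]
    exact Finset.sum_congr rfl fun u _ => Finset.prod_apply _ _ _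
  have hprod : ∀ (t : ℕ) (y : gBarCentralizer f (asSubspaces U) k k'), t ≤ numValues lam k' →
      ∏ l ∈ Finset.Icc 1 (multSum lam k' t / 2), zFun e f lam k k' (asSubspaces U) l y =
        (∏ r ∈ Finset.Icc 1 t,
          sigmaFun e f lam k k' (asSubspaces U) r (multVal lam k' r / 2)) y := by
    intro t y ht
    rw [Finset.prod_apply, ← hb.head.prod_lt_indexSet _ t ht]
    exact Finset.prod_congr rfl fun r _ => (hsig r _ y).symm
  have hval : ∀ (s j : ℕ), 1 ≤ s → s ≤ numValues lam k' → 1 ≤ j → j ≤ multVal lam k' s →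
      pBar e f ℓ pf lam k k' (asSubspaces U) (multSum lam k' (s - 1) + j) =
        (-1) ^ j *
          (∏ t ∈ Finset.Icc 1 (s - 1),
            sigmaFun e f lam k k' (asSubspaces U) t (multVal lam k' t / 2)) ^ 2 *
          ∑ r ∈ Finset.range (j + 1),
            sigmaFun e f lam k k' (asSubspaces U) s (j - r) *
              sigmaFun e f lam k k' (asSubspaces U) s r := by
    intro s j hs hsm hj1 hjk
    funext y
    have h1 := hb.toIsChainBasis.pPoly_eq hb.head hℓ hpf (i := multSum lam k' (s - 1) + j)
      (by omega) (hb.head.eq_muVal hs hsm hj1 hjk).1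
      (hb.exists_cornerCoeff_ne_zero hcompl hs hsm hj1 hjk) ⟨y, y.2.1⟩
    have h2 := hb.cornerCoeff_eq hcompl y hs hsm hj1 hjk
    rw [pBar, h1]
    refine h2.trans ?_
    rw [coeff_prod_one_sub_sq, hprod (s - 1) y (by omega)]
    simp only [Pi.mul_apply, Pi.pow_apply, Pi.neg_apply, Pi.one_apply, Finset.sum_apply, hsig]
    ring
  have hmain := hval s j hs1 hsm hj1 hjk
  refine ⟨?_, hmain⟩
  -- The first formula follows from the second once `p̄_{k_0 + ⋯ + k_{s-1}}` is known. For `s = 1`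
  -- it is `p_0 = 1`; otherwise it is the second formula for `s - 1` with `j = k_{s-1}`.
  have hpred : pBar e f ℓ pf lam k k' (asSubspaces U) (multSum lam k' (s - 1)) =
      (∏ t ∈ Finset.Icc 1 (s - 1),
        sigmaFun e f lam k k' (asSubspaces U) t (multVal lam k' t / 2)) ^ 2 := by
    obtain ⟨n, rfl⟩ : ∃ n, s = n + 1 := ⟨s - 1, by omega⟩
    rw [Nat.add_sub_cancel]
    rcases Nat.eq_zero_or_pos n with rfl | hn
    · funext y
      rw [multSum_zero, pBar, pPoly, if_pos rfl]
      simp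
    · have hp := multVal_pos lam k' hn (show n ≤ numValues lam k' by omega)
      have h1 := hval n (multVal lam k' n) hn (by omega) hp le_rfl
      rw [multSum_pred_add lam k' hn] at h1
      obtain ⟨a, ha⟩ := hb.head.even_multVal hn (show n ≤ numValues lam k' by omega)
      have hcard := hb.head.card_indexSet hn (show n ≤ numValues lam k' by omega)
      have hvan : ∀ r, a < r → sigmaFun e f lam k k' (asSubspaces U) n r = 0 := by
        intro r hr
        rw [sigmaFun, Finset.powersetCard_eq_empty.2 (by omega), Finset.sum_empty]
      -- Both degrees `k_n - r` and `r` must be at most `k_n / 2`, which leaves only `r = k_n / 2`.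
      have hsum : ∑ r ∈ Finset.range (multVal lam k' n + 1),
          sigmaFun e f lam k k' (asSubspaces U) n (multVal lam k' n - r) *
            sigmaFun e f lam k k' (asSubspaces U) n r =
          sigmaFun e f lam k k' (asSubspaces U) n (multVal lam k' n / 2) ^ 2 := by
        rw [Finset.sum_eq_single a, sq]
        · rw [show multVal lam k' n - a = multVal lam k' n / 2 by omega,
            show multVal lam k' n / 2 = a by omega]
        · intro r hr hra
          rcases lt_or_gt_of_ne hra with h | h
          · rw [hvan (multVal lam k' n - r) (by omega), zero_mul]
          · rw [hvan r h, mul_zero]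
        · intro h
          rw [Finset.mem_range] at h
          omega
      rw [h1, hsum, (show Even (multVal lam k' n) from ⟨a, ha⟩).neg_one_pow, one_mul, ← mul_pow]
      obtain ⟨m, rfl⟩ : ∃ m, n = m + 1 := ⟨n - 1, by omega⟩
      rw [Nat.add_sub_cancel, Finset.prod_Icc_succ_top (by omega)]
  rw [hpred]
  exact hmain
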